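/- Let $d\ge 3$, let $\mathbb D\subset\mathbb R^d$ be the open unit disk with the flat metric, $\Delta=-\sum_i\partial_i^2$, and let $\mathrm{Sym}$ denote the symmetric algebra of a real vector space. For $n\ge 0$ let $\mathbb{CE}(n)$ be the set of tuples $(\phi_1,\dots,\phi_n)$ of orientation-preserving conformal smooth open embeddings $\phi_i:\mathbb D\to\mathbb D$ with pairwise disjoint images; it is the set of such embeddings of the disjoint union of $n$ disks into $\mathbb D$, and the $\mathbb{CE}(n)$ form an operad under composition and permutation of the disks. For $\phi\in\mathbb{CE}(1)$ with conformal factor $\Omega_\phi>0$ (so $\phi^*g=\Omega_\phi^2g$) define $W_\phi:C_c^\infty(\mathbb D)\to C_c^\infty(\mathbb D)$ by $W_\phi(f)=(\Omega_\phi^{-(d+2)/2}f)\circ\phi^{-1}$ on $\phi(\mathbb D)$ and $0$ elsewhere, and let $W_\phi^0=\mathrm{Sym}(W_\phi)$. Let $\mathrm F_{\mathrm{CL}}(\mathbb D)$ be the cokernel of the linear map $\Delta^{\mathrm{BV}}:\mathrm{Sym}\,C_c^\infty(\mathbb D)\otimes C_c^\infty(\mathbb D)\to \mathrm{Sym}\,C_c^\infty(\mathbb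 D)$, $$\Delta^{\mathrm{BV}}(f_1\cdots f_n\otimes h)=-f_1\cdots f_n\cdot\Delta h+\sum_i\Big(\int_{\mathbb D}f_ih\,dx\Big)f_1\cdots\widehat{f_i}\cdots f_n ,$$ and let $S^{\mathrm{cl}}=C_c^\infty(\mathbb D)/\Delta C_c^\infty(\mathbb D)$. Let $G_d(x,y)=\frac{1}{(d-2)\omega_d\|x-y\|^{d-2}}$ with $\omega_d=\mathrm{vol}(S^{d-1})$, let $\partial_{G_d}(f,g)=\int_{\mathbb D\times\mathbb D}G_d(x,y)f(x)g(y)\,dx\,dy$, and extend it to $\mathrm{Sym}\,C_c^\infty(\mathbb D)$ by $\partial_{G_d}(f_1\cdots f_n)=\sum_{i<j}\partial_{G_d}(f_i,f_j)f_1\cdots\widehat{f_i}\cdots\widehat{f_j}\cdots f_n$. Then: 1. $\exp(\partial_{G_d})$ induces a linear isomorphism $\Psi_G:\mathrm F_{\mathrm{CL}}(\mathbb D)\to\mathrm{Sym}(S^{\mathrm{cl}})$. For $\phi\in\mathbb{CE}(1)$ the map $W^0_\phi$ induces linear maps $\mathrm F_{\mathrm{CL}}(\phi)$ on $\mathrm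 F_{\mathrm{CL}}(\mathbb D)$ and $W_\phi^{\mathrm{cl}}$ on $\mathrm{Sym}(S^{\mathrm{cl}})$, both $\phi\mapsto \mathrm F_{\mathrm{CL}}(\phi)$ and $\phi\mapsto W^{\mathrm{cl}}_\phi$ are monoid homomorphisms, and $\Psi_G\circ\mathrm F_{\mathrm{CL}}(\phi)=W_\phi^{\mathrm{cl}}\circ\Psi_G$. 2. For $\phi_{[n]}=(\phi_1,\dots,\phi_n)\in\mathbb{CE}(n)$ there is a well-defined linear map $\mathrm F_{\mathrm{CL}}(\phi_{[n]}):\mathrm F_{\mathrm{CL}}(\mathbb D)^{\otimes n}\to\mathrm F_{\mathrm{CL}}(\mathbb D)$, $[x_1]\otimes\cdots\otimes[x_n]\mapsto[W^0_{\phi_1}(x_1)\cdots W^0_{\phi_n}(x_n)]$, and the maps $\rho^{\mathrm{cl}}_{\phi_{[n]}}=\Psi_G\circ\mathrm F_{\mathrm{CL}}(\phi_{[n]})\circ(\Psi_G^{-1})^{\otimes n}$ make $\mathrm{Sym}(S^{\mathrm{cl}})$ an algebra over the operad $\mathbb{CE}$. 3. $\rho_\phi^{\mathrm{cl}}=W_\phi^{\mathrm{cl}}$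 for every $\phi\in\mathbb{CE}(1)$. 4. For every $n\ge0$, $\phi_{[n]}\in\mathbb{CE}(n)$ and monomials $F_i=[f_{i,1}]\cdots[f_{i,m_i}]$ $(1\le i\le n)$ with $f_{i,a}\in C_c^\infty(\mathbb D)$, writing $g_{(i,a)}=W_{\phi_i}(f_{i,a})$, $$\rho^{\mathrm{cl}}_{\phi_{[n]}}(F_1\otimes\cdots\otimes F_n)=\prod_{i=1}^nW_{\phi_i}^{\mathrm{cl}}(F_i)+\sum_{C\ne\emptyset}\ \prod_{\{s,t\}\in C}\partial_{G_d}(g_s,g_t)\prod_{s\notin\bigcup C}[g_s],$$ where $C$ runs over all non-empty sets of pairwise disjoint pairs $\{(i,a),(j,b)\}$ with $i\neq j$ of factors. -/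

import Mathlib

noncomputable section
namespace ConfFA

section Algebra
open SymmetricAlgebra TensorProduct

variable {V : Type*} [AddCommGroup V] [Module ℝ V]

/-- A linear map from `V` to an algebra whose values commute extends to an algebra homomorphism
on the symmetric algebra. -/
def symLift {A : Type*} [Ring A] [Algebra ℝ A] (T : V →ₗ[ℝ] A)
    (hT : ∀ f g, T f * T g = T g * T f) : SymmetricAlgebra ℝ V →ₐ[ℝ] A :=
  RingCon.liftₐ (TensorAlgebra.symRingCon ℝ V)
    (TensorAlgebra.lift ℝ T) <| RingCon.ringConGen_le.2 fun x y h => by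
      rw [RingCon.ker_apply]
      induction h with
      | mul_comm f g => simp [hT f g]

theorem symLift_ι {A : Type*} [Ring A] [Algebra ℝ A] (T : V →ₗ[ℝ] A)
    (hT : ∀ f g, T f * T g = T g * T f) (f : V) : symLift T hT (ι ℝ V f) = T f := by
  refine (RingCon.liftₐ_mk (TensorAlgebra.symRingCon ℝ V) _ _ (TensorAlgebra.ι ℝ f)).trans ?_
  simp

/-- The derivation of `Sym V` with `f ↦ l f` on `V`. -/
def symDeriv (l : V →ₗ[ℝ] ℝ) : SymmetricAlgebra ℝ V →ₗ[ℝ] SymmetricAlgebra ℝ V :=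
  (TrivSqZeroExt.sndHom (SymmetricAlgebra ℝ V) (SymmetricAlgebra ℝ V)).restrictScalars ℝ ∘ₗ
  (SymmetricAlgebra.lift (A := DualNumber (SymmetricAlgebra ℝ V))
    ((TrivSqZeroExt.inlAlgHom ℝ (SymmetricAlgebra ℝ V) (SymmetricAlgebra ℝ V)).toLinearMap ∘ₗ ι ℝ V +
      (TrivSqZeroExt.inrHom (SymmetricAlgebra ℝ V) (SymmetricAlgebra ℝ V)).restrictScalars ℝ ∘ₗ
        Algebra.linearMap ℝ (SymmetricAlgebra ℝ V) ∘ₗ l)).toLinearMap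

theorem symDeriv_ι (l : V →ₗ[ℝ] ℝ) (f : V) : symDeriv l (ι ℝ V f) = algebraMap ℝ _ (l f) := by
  simp [symDeriv, Algebra.algebraMap_eq_smul_one]

theorem symDeriv_algebraMap (l : V →ₗ[ℝ] ℝ) (r : ℝ) :
    symDeriv l (algebraMap ℝ _ r) = 0 := by
  simp [symDeriv, AlgHom.commutes, TrivSqZeroExt.algebraMap_eq_inl']

theorem symDeriv_mul (l : V →ₗ[ℝ] ℝ) (x y : SymmetricAlgebra ℝ V) :
    symDeriv l (x * y) = x * symDeriv l y + symDeriv l x * y := by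
  have key : ∀ z : SymmetricAlgebra ℝ V, TrivSqZeroExt.fst
      (SymmetricAlgebra.lift (A := DualNumber (SymmetricAlgebra ℝ V))
    ((TrivSqZeroExt.inlAlgHom ℝ (SymmetricAlgebra ℝ V) (SymmetricAlgebra ℝ V)).toLinearMap ∘ₗ ι ℝ V +
      (TrivSqZeroExt.inrHom (SymmetricAlgebra ℝ V) (SymmetricAlgebra ℝ V)).restrictScalars ℝ ∘ₗ
        Algebra.linearMap ℝ (SymmetricAlgebra ℝ V) ∘ₗ l) z) = z := by
    intro z
    induction z using SymmetricAlgebra.induction with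
    | algebraMap r => simp [AlgHom.commutes, TrivSqZeroExt.algebraMap_eq_inl']
    | ι x => simp
    | mul a b ha hb => simp [ha, hb]
    | add a b ha hb => simp [ha, hb]
  simp [symDeriv, key, mul_comm]

theorem symDeriv_unique (l : V →ₗ[ℝ] ℝ) (D : SymmetricAlgebra ℝ V →ₗ[ℝ] SymmetricAlgebra ℝ V)
    (h1 : D 1 = 0) (hD : ∀ f, D (ι ℝ V f) = algebraMap ℝ _ (l f))
    (hm : ∀ x y, D (x * y) = x * D y + D x * y) : D = symDeriv l := by
  ext x
  induction x using SymmetricAlgebra.induction with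
  | algebraMap r => rw [symDeriv_algebraMap, Algebra.algebraMap_eq_smul_one, map_smul, h1, smul_zero]
  | ι x => rw [hD, symDeriv_ι]
  | mul a b ha hb => rw [hm, symDeriv_mul, ha, hb]
  | add a b ha hb => rw [map_add, map_add, ha, hb]

/-- `symDeriv l` as a linear function of `l`. -/
def symDerivₗ : (V →ₗ[ℝ] ℝ) →ₗ[ℝ]
    SymmetricAlgebra ℝ V →ₗ[ℝ] SymmetricAlgebra ℝ V where
  toFun := symDeriv
  map_add' l m := by
    refine (symDeriv_unique _ _ ?_ ?_ ?_).symm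
    · have := fun l : V →ₗ[ℝ] ℝ => symDeriv_algebraMap l 1
      simp only [map_one] at this
      simp [this]
    · intro f; simp [symDeriv_ι]
    · intro x y; simp only [LinearMap.add_apply, symDeriv_mul]; ring
  map_smul' c l := by
    refine (symDeriv_unique _ _ ?_ ?_ ?_).symm
    · have := fun l : V →ₗ[ℝ] ℝ => symDeriv_algebraMap l 1
      simp only [map_one] at this
      simp [this]
    · intro f; simp [symDeriv_ι, Algebra.smul_def]
    · intro x y; simp [LinearMap.smul_apply, symDeriv_mul, smul_add]

theorem symDeriv_comm (l m : V →ₗ[ℝ] ℝ) (x : SymmetricAlgebra ℝ V) :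
    symDeriv l (symDeriv m x) = symDeriv m (symDeriv l x) := by
  induction x using SymmetricAlgebra.induction with
  | algebraMap r => simp [symDeriv_algebraMap]
  | ι x => simp [symDeriv_ι, symDeriv_algebraMap]
  | mul a b ha hb => simp only [symDeriv_mul, map_add, ha, hb]; ring
  | add a b ha hb => simp only [map_add, ha, hb]

/-- The operators `(x, y) ↦ (f x, f y + D_f x)`, with `D_f` the derivation `g ↦ B f g`; they are
used to define `contraction` by recursion on the number of factors. -/
def contractionAux (B : V →ₗ[ℝ] V →ₗ[ℝ] ℝ) :
    V →ₗ[ℝ] Module.End ℝ (SymmetricAlgebra ℝ V × SymmetricAlgebra ℝ V) where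
  toFun f := (LinearMap.mulLeft ℝ (ι ℝ V f) ∘ₗ LinearMap.fst ℝ _ _).prod
    (LinearMap.mulLeft ℝ (ι ℝ V f) ∘ₗ LinearMap.snd ℝ _ _ + symDerivₗ (B f) ∘ₗ LinearMap.fst ℝ _ _)
  map_add' f g := by ext <;> simp [add_mul] 
  map_smul' c f := by ext <;> simp 

theorem contractionAux_comm (B : V →ₗ[ℝ] V →ₗ[ℝ] ℝ) (hB : ∀ f g, B f g = B g f) (f g : V) : contractionAux B f * contractionAux B g =
    contractionAux B g * contractionAux B f := by
  refine LinearMap.ext fun p => Prod.ext ?_ ?_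
  · simp [contractionAux, mul_left_comm]
  · simp [contractionAux, symDerivₗ, symDeriv_mul, symDeriv_ι, hB g f]; ring

variable (B : V →ₗ[ℝ] V →ₗ[ℝ] ℝ) (hB : ∀ f g, B f g = B g f)

theorem contractionAux_apply (f : V) (p : SymmetricAlgebra ℝ V × SymmetricAlgebra ℝ V) :
    contractionAux B f p = (ι ℝ V f * p.1, ι ℝ V f * p.2 + symDeriv (B f) p.1) := rfl

/-- The second order operator `∂_B` on `Sym V` attached to a symmetric bilinear form `B`; see
`contraction_prod` for the formula
`f₁ ⋯ fₙ ↦ ∑_{i < j} B(fᵢ, fⱼ) f₁ ⋯ f̂ᵢ ⋯ f̂ⱼ ⋯ fₙ` which determines it. -/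
def contraction : SymmetricAlgebra ℝ V →ₗ[ℝ] SymmetricAlgebra ℝ V :=
  LinearMap.snd ℝ (SymmetricAlgebra ℝ V) (SymmetricAlgebra ℝ V) ∘ₗ
    LinearMap.applyₗ ((1, 0) : SymmetricAlgebra ℝ V × SymmetricAlgebra ℝ V) ∘ₗ
    (symLift (A := Module.End ℝ (SymmetricAlgebra ℝ V × SymmetricAlgebra ℝ V))
      (contractionAux B) (contractionAux_comm B hB)).toLinearMap

theorem contraction_one : contraction B hB 1 = 0 := by
  simp [contraction]

theorem sym_induction_ι_mul {p : SymmetricAlgebra ℝ V → Prop} (one : p 1)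
    (add : ∀ x y, p x → p y → p (x + y)) (smul : ∀ (r : ℝ) x, p x → p (r • x))
    (mul : ∀ f x, p x → p (ι ℝ V f * x)) (x : SymmetricAlgebra ℝ V) : p x := by
  have key : ∀ a x, p x → p (a * x) := by
    intro a
    induction a using SymmetricAlgebra.induction with
    | algebraMap r => intro x hx; rw [← Algebra.smul_def]; exact smul r x hx
    | ι f => exact mul f
    | mul a b ha hb => intro x hx; rw [mul_assoc]; exact ha _ (hb _ hx)
    | add a b ha hb => intro x hx; rw [add_mul]; exact add _ _ (ha _ hx) (hb _ hx)
  simpa using key x 1 one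

theorem contraction_ι_mul (f : V) (x : SymmetricAlgebra ℝ V) :
    contraction B hB (ι ℝ V f * x) = ι ℝ V f * contraction B hB x + symDeriv (B f) x := by
  have key : ∀ x, (symLift (A := Module.End ℝ (SymmetricAlgebra ℝ V × SymmetricAlgebra ℝ V))
      (contractionAux B) (contractionAux_comm B hB) x
      ((1, 0) : SymmetricAlgebra ℝ V × SymmetricAlgebra ℝ V)).1 = x := by
    intro x
    induction x using sym_induction_ι_mul with
    | one => simp
    | add x y hx hy => simp [hx, hy]
    | smul r x hx => simp [hx]
    | mul f x hx => simp [symLift_ι, contractionAux_apply, hx]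
  simp [contraction, symLift_ι, contractionAux_apply, key]

theorem contraction_symDeriv (l : V →ₗ[ℝ] ℝ) (x : SymmetricAlgebra ℝ V) :
    contraction B hB (symDeriv l x) = symDeriv l (contraction B hB x) := by
  induction x using sym_induction_ι_mul with
  | one =>
    have := symDeriv_algebraMap l 1
    rw [map_one] at this
    simp [this, contraction_one]
  | add x y hx hy => simp [hx, hy]
  | smul r x hx => simp [hx]
  | mul f x hx =>
    simp only [symDeriv_mul, map_add, contraction_ι_mul, hx, symDeriv_ι,
      ← Algebra.smul_def, map_smul, symDeriv_comm l (B f)]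
    ring

theorem symDeriv_prod (l : V →ₗ[ℝ] ℝ) {n : ℕ} (f : Fin n → V) :
    symDeriv l (∏ i, ι ℝ V (f i)) = ∑ i, l (f i) • ∏ j with j ≠ i, ι ℝ V (f j) := by
  induction n with
  | zero => simpa using symDeriv_algebraMap l 1
  | succ n ih =>
    rw [Fin.prod_univ_succ, symDeriv_mul, ih, symDeriv_ι, ← Algebra.smul_def, Fin.sum_univ_succ,
      add_comm, Finset.mul_sum]
    simp only [Finset.prod_filter, Fin.prod_univ_succ]
    simp [Fin.succ_ne_zero, (Fin.succ_ne_zero _).symm]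

theorem contraction_prod {n : ℕ} (f : Fin n → V) :
    contraction B hB (∏ i, ι ℝ V (f i)) =
      ∑ i, ∑ j with i < j, B (f i) (f j) • ∏ k with k ≠ i ∧ k ≠ j, ι ℝ V (f k) := by
  induction n with
  | zero => simp [contraction_one]
  | succ n ih =>
    rw [Fin.prod_univ_succ, contraction_ι_mul, ih, symDeriv_prod, Fin.sum_univ_succ,
      add_comm, Finset.mul_sum]
    simp only [Finset.prod_filter, Finset.sum_filter, Fin.prod_univ_succ, Fin.sum_univ_succ]
    simp [Fin.succ_ne_zero, (Fin.succ_ne_zero _).symm, Finset.mul_sum]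

theorem contraction_locally_nilpotent (x : SymmetricAlgebra ℝ V) :
    ∃ N, ∀ k, N ≤ k → (contraction B hB ^ k) x = 0 := by
  induction x using sym_induction_ι_mul with
  | one => exact ⟨1, fun k hk => by
      obtain ⟨k, rfl⟩ := Nat.exists_eq_add_of_le' hk
      rw [pow_succ, Module.End.mul_apply, contraction_one, map_zero]⟩
  | add x y hx hy =>
    obtain ⟨N, hN⟩ := hx
    obtain ⟨M, hM⟩ := hy
    exact ⟨max N M, fun k hk => by
      rw [map_add, hN k (le_trans (le_max_left _ _) hk), hM k (le_trans (le_max_right _ _) hk),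
        add_zero]⟩
  | smul r x hx =>
    obtain ⟨N, hN⟩ := hx
    exact ⟨N, fun k hk => by rw [map_smul, hN k hk, smul_zero]⟩
  | mul f x hx =>
    obtain ⟨N, hN⟩ := hx
    have key : ∀ k : ℕ, (contraction B hB ^ (k + 1)) (ι ℝ V f * x) =
        ι ℝ V f * (contraction B hB ^ (k + 1)) x +
          ((k : ℝ) + 1) • symDeriv (B f) ((contraction B hB ^ k) x) := by
      intro k
      induction k with
      | zero => simp [contraction_ι_mul]
      | succ k ih =>
        rw [pow_succ', Module.End.mul_apply, ih, map_add, contraction_ι_mul, map_smul,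
          contraction_symDeriv]
        simp only [← Module.End.mul_apply, ← pow_succ']
        push_cast
        module
    refine ⟨N + 1, fun k hk => ?_⟩
    obtain ⟨k, rfl⟩ := Nat.exists_eq_add_of_le' (le_trans (Nat.le_add_left 1 N) hk)
    rw [key, hN _ (by omega), hN _ (by omega)]
    simp

theorem contraction_exp_support (x : SymmetricAlgebra ℝ V) : (Function.support fun k : ℕ =>
    ((k.factorial : ℝ)⁻¹ • (contraction B hB ^ k) x)).Finite := by
  obtain ⟨N, hN⟩ := contraction_locally_nilpotent B hB x
  refine (Set.finite_lt_nat N).subset fun k hk => ?_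
  by_contra h
  exact hk (by simp [hN k (not_lt.1 h)])

/-- `exp (∂_B) = ∑ₖ ∂_Bᵏ / k!`; the sum is finite on every element. -/
def expContraction : SymmetricAlgebra ℝ V →ₗ[ℝ] SymmetricAlgebra ℝ V where
  toFun x := ∑ᶠ k : ℕ, (k.factorial : ℝ)⁻¹ • (contraction B hB ^ k) x
  map_add' x y := by
    rw [← finsum_add_distrib (contraction_exp_support B hB x) (contraction_exp_support B hB y)]
    simp
  map_smul' r x := by
    rw [RingHom.id_apply, smul_finsum' r (contraction_exp_support B hB x)]
    simp [smul_comm r]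

/-- The linear map `Sym V ⊗ V → Sym V`,
`f₁ ⋯ fₙ ⊗ h ↦ - f₁ ⋯ fₙ · L h + ∑ᵢ B(fᵢ, h) f₁ ⋯ f̂ᵢ ⋯ fₙ`; see `bvOperator_tmul`. -/
def bvOperator (L : V →ₗ[ℝ] V) :
    SymmetricAlgebra ℝ V ⊗[ℝ] V →ₗ[ℝ] SymmetricAlgebra ℝ V :=
  TensorProduct.lift <| LinearMap.flip <|
    (symDerivₗ ∘ₗ B.flip - LinearMap.mul ℝ (SymmetricAlgebra ℝ V) ∘ₗ ι ℝ V ∘ₗ L)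

theorem bvOperator_tmul (L : V →ₗ[ℝ] V) {n : ℕ} (f : Fin n → V) (h : V) :
    bvOperator B L ((∏ i, ι ℝ V (f i)) ⊗ₜ h) =
      -((∏ i, ι ℝ V (f i)) * ι ℝ V (L h)) +
        ∑ i, B (f i) h • ∏ j with j ≠ i, ι ℝ V (f j) := by
  simpa [bvOperator, symDerivₗ, sub_eq_add_neg, add_comm, mul_comm] using
    symDeriv_prod (B.flip h) f

/-- The algebra homomorphism `Sym T : Sym V → Sym W`. -/
def symMap {W : Type*} [AddCommGroup W] [Module ℝ W] (T : V →ₗ[ℝ] W) :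
    SymmetricAlgebra ℝ V →ₐ[ℝ] SymmetricAlgebra ℝ W :=
  SymmetricAlgebra.lift (ι ℝ W ∘ₗ T)

end Algebra

section Analysis
open Set MeasureTheory TopologicalSpace
open scoped ContDiff

/-- Euclidean space `ℝᵈ`. -/
abbrev Euc (d : ℕ) : Type := EuclideanSpace ℝ (Fin d)

/-- The open unit disk `𝔻` in `ℝᵈ`. -/
def disk (d : ℕ) : Opens (Euc d) := ⟨Metric.ball 0 1, Metric.isOpen_ball⟩

/-- `C_c^∞(𝔻)`: smooth real functions with compact support contained in `𝔻`. -/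
abbrev Test (d : ℕ) : Type := TestFunction (disk d) ℝ ⊤

variable {d : ℕ}

theorem Test.contDiff (f : Test d) : ContDiff ℝ ∞ f := TestFunction.contDiff f

theorem contDiff_lap {f : Euc d → ℝ} (hf : ContDiff ℝ ∞ f) : ContDiff ℝ ∞ (Laplacian.laplacian f) := by
  rw [InnerProductSpace.laplacian_eq_iteratedFDeriv_stdOrthonormalBasis]
  refine ContDiff.sum fun i _ => ?_
  have h : ContDiff ℝ ∞ (iteratedFDeriv ℝ 2 f) :=
    hf.iteratedFDeriv_right (by norm_cast)
  exact (ContinuousMultilinearMap.apply ℝ (fun _ : Fin 2 => Euc d) ℝ _).contDiff.comp h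

theorem tsupport_lap (f : Euc d → ℝ) : tsupport (Laplacian.laplacian f) ⊆ tsupport f := by
  refine closure_minimal (fun x hx => ?_) isClosed_closure
  contrapose! hx
  rw [Function.notMem_support]
  have h : f =ᶠ[nhds x] fun _ => (0 : ℝ) := notMem_tsupport_iff_eventuallyEq.1 hx
  rw [(InnerProductSpace.laplacian_congr_nhds h).eq_of_nhds]
  simp

theorem Test.add_apply (f g : Test d) (x : Euc d) : (f + g) x = f x + g x := rfl

theorem Test.smul_apply (c : ℝ) (f : Test d) (x : Euc d) : (c • f) x = c * f x := rfl

/-- The positive Laplacian `- ∑ᵢ ∂ᵢ²` on `C_c^∞(𝔻)`. It is the conformal Laplacian of the flat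
metric. -/
def lap : Test d →ₗ[ℝ] Test d where
  toFun f :=
    { toFun := -Laplacian.laplacian (f : Euc d → ℝ)
      contDiff' := (contDiff_lap f.contDiff).neg
      hasCompactSupport' := IsCompact.of_isClosed_subset f.hasCompactSupport.isCompact
        (isClosed_tsupport _) (by rw [tsupport_neg]; exact tsupport_lap f)
      tsupport_subset' := by
        rw [tsupport_neg]; exact (tsupport_lap f).trans f.tsupport_subset }
  map_add' f g := by
    ext x
    have h : Laplacian.laplacian (⇑f + ⇑g) x =
        Laplacian.laplacian (⇑f) x + Laplacian.laplacian (⇑g) x :=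
      ContDiffAt.laplacian_add (f.contDiff.contDiffAt.of_le (by norm_cast))
        (g.contDiff.contDiffAt.of_le (by norm_cast))
    change -(Laplacian.laplacian (⇑f + ⇑g) x) =
      -(Laplacian.laplacian (⇑f) x) + -(Laplacian.laplacian (⇑g) x)
    rw [h, neg_add]
  map_smul' c f := by
    ext x
    have h : Laplacian.laplacian (c • ⇑f) x = c • Laplacian.laplacian (⇑f) x :=
      InnerProductSpace.laplacian_smul c (f.contDiff.contDiffAt.of_le (by norm_cast))
    change -(Laplacian.laplacian (c • ⇑f) x) = c • -(Laplacian.laplacian (⇑f) x)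
    rw [h, smul_neg]

theorem integrable_mul (f g : Test d) : Integrable fun x => f x * g x :=
  (f.continuous.mul g.continuous).integrable_of_hasCompactSupport f.hasCompactSupport.mul_right

/-- The pairing `(f, g) ↦ ∫_𝔻 f g`. -/
def l2 : Test d →ₗ[ℝ] Test d →ₗ[ℝ] ℝ :=
  LinearMap.mk₂ ℝ (fun f g => ∫ x in (disk d : Set (Euc d)), f x * g x)
    (fun f f' g => by
      simp only [Test.add_apply, add_mul]
      exact integral_add (integrable_mul f g).integrableOn (integrable_mul f' g).integrableOn)
    (fun c f g => by simp [mul_assoc, integral_const_mul])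
    (fun f g g' => by
      simp only [Test.add_apply, mul_add]
      exact integral_add (integrable_mul f g).integrableOn (integrable_mul f g').integrableOn)
    (fun c f g => by simp [mul_left_comm, integral_const_mul])

section kernel
variable (P : Euc d × Euc d → ℝ) (hP : LocallyIntegrable P)

theorem integrable_kernel (P : Euc d × Euc d → ℝ) (hP : LocallyIntegrable P) (f g : Test d) :
    Integrable fun p : Euc d × Euc d => P p * f p.1 * g p.2 := by
  have hc : HasCompactSupport fun p : Euc d × Euc d => f p.1 * g p.2 := by
    refine HasCompactSupport.of_support_subset_isCompact
      (f.hasCompactSupport.isCompact.prod g.hasCompactSupport.isCompact) fun p hp => ?_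
    rw [Function.mem_support, mul_ne_zero_iff] at hp
    exact ⟨subset_tsupport _ hp.1, subset_tsupport _ hp.2⟩
  have hcont : Continuous fun p : Euc d × Euc d => f p.1 * g p.2 := by
    have := f.continuous; have := g.continuous; fun_prop
  refine (hP.integrable_smul_left_of_hasCompactSupport hcont hc).congr (.of_forall fun p => ?_)
  simp only [smul_eq_mul]
  ring

/-- The bilinear form `∂_P(f, g) = ∫_{𝔻 × 𝔻} P(x, y) f(x) g(y) dx dy` of a locally integrable
kernel `P`. -/
def kernelPairing : Test d →ₗ[ℝ] Test d →ₗ[ℝ] ℝ :=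
  LinearMap.mk₂ ℝ (fun f g => ∫ p in (disk d : Set (Euc d)) ×ˢ (disk d : Set (Euc d)),
      P p * f p.1 * g p.2)
    (fun f f' g => by
      simp only [Test.add_apply, add_mul, mul_add]
      exact integral_add (integrable_kernel P hP f g).integrableOn
        (integrable_kernel P hP f' g).integrableOn)
    (fun c f g => by
      rw [smul_eq_mul, ← integral_const_mul]; congr 1; ext p; simp only [Test.smul_apply]; ring)
    (fun f g g' => by
      simp only [Test.add_apply, mul_add]
      exact integral_add (integrable_kernel P hP f g).integrableOn
        (integrable_kernel P hP f g').integrableOn)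
    (fun c f g => by
      rw [smul_eq_mul, ← integral_const_mul]; congr 1; ext p; simp only [Test.smul_apply]; ring)

theorem kernelPairing_symm (hs : ∀ x y, P (x, y) = P (y, x)) (f g : Test d) :
    kernelPairing P hP f g = kernelPairing P hP g f := by
  simp only [kernelPairing, LinearMap.mk₂_apply]
  rw [Measure.volume_eq_prod, ← Measure.prod_restrict, ← integral_prod_swap]
  refine integral_congr_ae (.of_forall fun p => ?_)
  simp only [Prod.swap, hs p.2 p.1]
  ring
end kernel

/-- `ω_d`, the volume of the unit sphere `S^{d-1}` in `ℝᵈ`. -/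
def sphereVol (d : ℕ) : ℝ := (volume : Measure (Euc d)).toSphere.real univ

/-- The Green function `G_d(x, y) = 1 / ((d - 2) ω_d ‖x - y‖^{d-2})` (meaningful for `d ≥ 3`). -/
def green (p : Euc d × Euc d) : ℝ := 1 / (((d : ℝ) - 2) * sphereVol d * ‖p.1 - p.2‖ ^ (d - 2))

theorem integrableOn_norm_inv (hd : 3 ≤ d) (r : ℝ) :
    IntegrableOn (fun z : Euc d => 1 / ‖z‖ ^ (d - 2)) (Metric.ball 0 r) := by
  have : Nonempty (Fin d) := ⟨⟨0, by omega⟩⟩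
  rw [integrableOn_fun_norm_addHaar volume (f := fun y => 1 / y ^ (d - 2))]
  have h : IntegrableOn (fun y : ℝ => y) (Ioo 0 r) :=
    (continuous_id.locallyIntegrable.integrableOn_isCompact isCompact_Icc).mono_set Ioo_subset_Icc_self
  refine h.congr_fun (fun y hy => ?_) measurableSet_Ioo
  have hy0 : y ≠ 0 := hy.1.ne'
  obtain ⟨k, rfl⟩ := Nat.exists_eq_add_of_le' hd
  simp only [finrank_euclideanSpace, Fintype.card_fin, smul_eq_mul]
  rw [show k + 3 - 1 = k + 3 - 2 + 1 by omega, pow_succ]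
  field_simp

theorem locallyIntegrable_green : LocallyIntegrable (green (d := d)) := by
  rcases lt_or_ge d 3 with hd | hd
  · have : green (d := d) = fun _ => 1 / (((d : ℝ) - 2) * sphereVol d) := by
      ext p
      simp [green, show d - 2 = 0 by omega]
    rw [this]
    exact locallyIntegrable_const _
  · suffices h : LocallyIntegrable fun p : Euc d × Euc d => 1 / ‖p.1 - p.2‖ ^ (d - 2) by
      have h2 := h.smul (1 / (((d : ℝ) - 2) * sphereVol d))
      refine h2.congr (.of_forall fun p => ?_)
      simp [green, mul_comm]
    rw [locallyIntegrable_iff]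
    intro K hK
    obtain ⟨r, hr⟩ := hK.isBounded.subset_ball 0
    have h1 := (integrable_indicator_iff Metric.isOpen_ball.measurableSet).2
      (integrableOn_norm_inv hd (r + r))
    have h2 : Integrable ((Metric.ball (0 : Euc d) r).indicator fun _ => (1 : ℝ)) :=
      (integrable_indicator_iff Metric.isOpen_ball.measurableSet).2
        (integrableOn_const Metric.isBounded_ball.measure_lt_top.ne)
    have h3 := (measurePreserving_sub_prod (volume : Measure (Euc d)) (volume : Measure (Euc d))).integrable_comp_of_integrable
      (h1.mul_prod h2)
    refine (h3.integrableOn (s := K)).congr ?_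
    filter_upwards [ae_restrict_mem hK.measurableSet] with p hp
    have hp' := hr hp
    rw [mem_ball_zero_iff, Prod.norm_def, max_lt_iff] at hp'
    have h4 : p.1 - p.2 ∈ Metric.ball (0 : Euc d) (r + r) := by
      rw [mem_ball_zero_iff]
      exact (norm_sub_le _ _).trans_lt (add_lt_add hp'.1 hp'.2)
    have h5 : p.2 ∈ Metric.ball (0 : Euc d) r := mem_ball_zero_iff.2 hp'.2
    simp [indicator_of_mem h4, indicator_of_mem h5]

open Classical in
/-- The extension by zero of a self-map of the disk to `ℝᵈ`; only used to take derivatives at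
points of the open disk. -/
def extend (φ : disk d → disk d) (x : Euc d) : Euc d :=
  if h : x ∈ disk d then (φ ⟨x, h⟩ : Euc d) else 0

theorem extend_coe (φ : disk d → disk d) (x : disk d) : extend φ x = φ x := by
  simp [extend]

theorem extend_mem (φ : disk d → disk d) {x : Euc d} (hx : x ∈ disk d) : extend φ x ∈ disk d := by
  rw [extend, dif_pos hx]; exact (φ _).2

theorem extend_comp (φ ψ : disk d → disk d) {x : Euc d} (hx : x ∈ disk d) :
    extend (φ ∘ ψ) x = extend φ (extend ψ x) := by
  simp [extend, hx]

theorem extend_id_eventuallyEq {x : Euc d} (hx : x ∈ disk d) :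
    extend (id : disk d → disk d) =ᶠ[nhds x] id := by
  filter_upwards [(disk d).2.mem_nhds hx] with y hy
  exact extend_coe id ⟨y, hy⟩

theorem extend_comp_eventuallyEq (φ ψ : disk d → disk d) {x : Euc d} (hx : x ∈ disk d) :
    extend (φ ∘ ψ) =ᶠ[nhds x] extend φ ∘ extend ψ := by
  filter_upwards [(disk d).2.mem_nhds hx] with y hy
  exact extend_comp φ ψ hy

/-- Orientation-preserving conformal open embeddings `𝔻 → 𝔻` (not necessarily surjective). -/
@[ext]
structure ConfEmb (d : ℕ) where
  /-- The underlying map. -/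
  toFun : disk d → disk d
  isOpenEmbedding : Topology.IsOpenEmbedding toFun
  smooth : ContDiffOn ℝ ∞ (extend toFun) (disk d)
  conformal : ∃ Ω : Euc d → ℝ, ContDiffOn ℝ ∞ Ω (disk d) ∧ ∀ x ∈ disk d, 0 < Ω x ∧
    ∀ u v : Euc d, inner ℝ (fderiv ℝ (extend toFun) x u) (fderiv ℝ (extend toFun) x v) =
      Ω x ^ 2 * inner ℝ u v
  orientation : ∀ x ∈ disk d, 0 < (fderiv ℝ (extend toFun) x).det

namespace ConfEmb

theorem contDiffAt (φ : ConfEmb d) {x : Euc d} (hx : x ∈ disk d) :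
    ContDiffAt ℝ ∞ (extend φ.toFun) x :=
  φ.smooth.contDiffAt ((disk d).2.mem_nhds hx)

theorem fderiv_extend_comp (φ ψ : ConfEmb d) {x : Euc d} (hx : x ∈ disk d) :
    fderiv ℝ (extend (φ.toFun ∘ ψ.toFun)) x =
      (fderiv ℝ (extend φ.toFun) (extend ψ.toFun x)).comp (fderiv ℝ (extend ψ.toFun) x) := by
  rw [(extend_comp_eventuallyEq _ _ hx).fderiv_eq]
  exact fderiv_comp x ((φ.contDiffAt (extend_mem _ hx)).differentiableAt (by simp))
    ((ψ.contDiffAt hx).differentiableAt (by simp))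

instance : One (ConfEmb d) where
  one :=
    { toFun := id
      isOpenEmbedding := .id
      smooth := contDiffOn_id.congr fun x hx => (extend_id_eventuallyEq hx).eq_of_nhds
      conformal := ⟨fun _ => 1, contDiffOn_const, fun x hx => ⟨one_pos, fun u v => by
        rw [(extend_id_eventuallyEq hx).fderiv_eq]; simp⟩⟩
      orientation := fun x hx => by
        rw [(extend_id_eventuallyEq hx).fderiv_eq, fderiv_id]; simp [ContinuousLinearMap.det] }

instance : Mul (ConfEmb d) where
  mul φ ψ :=
    { toFun := φ.toFun ∘ ψ.toFun
      isOpenEmbedding := φ.isOpenEmbedding.comp ψ.isOpenEmbedding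
      smooth := (φ.smooth.comp ψ.smooth fun _ hx => extend_mem _ hx).congr
        fun _ hx => extend_comp _ _ hx
      conformal := by
        obtain ⟨Ω, hΩ, h⟩ := φ.conformal
        obtain ⟨Θ, hΘ, k⟩ := ψ.conformal
        refine ⟨fun x => Ω (extend ψ.toFun x) * Θ x,
          (hΩ.comp ψ.smooth fun _ hx => extend_mem _ hx).mul hΘ, fun x hx =>
          ⟨mul_pos (h _ (extend_mem _ hx)).1 (k x hx).1, fun u v => ?_⟩⟩
        rw [fderiv_extend_comp φ ψ hx, ContinuousLinearMap.comp_apply,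
          ContinuousLinearMap.comp_apply, (h _ (extend_mem _ hx)).2, (k x hx).2]
        ring
      orientation := fun x hx => by
        rw [fderiv_extend_comp φ ψ hx]
        have h := mul_pos (φ.orientation _ (extend_mem ψ.toFun hx)) (ψ.orientation x hx)
        rwa [ContinuousLinearMap.det, ContinuousLinearMap.det, ← LinearMap.det_comp] at h }

/-- The monoid of conformal open embeddings under composition. -/
instance : Monoid (ConfEmb d) where
  mul_assoc _ _ _ := rfl
  one_mul _ := rfl
  mul_one _ := rfl

/-- The conformal factor `Ω_φ > 0`, `φ^* g = Ω_φ² g` (for `d ≥ 1` it is unique on the disk). -/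
def factor (φ : ConfEmb d) : Euc d → ℝ := φ.conformal.choose

open Classical in
/-- `Ω_φ(φ⁻¹ y)^{-(d+2)/2} f(φ⁻¹ y)` for `y ∈ φ(𝔻)`, and `0` elsewhere. -/
def weight (φ : ConfEmb d) (f : Euc d → ℝ) (y : Euc d) : ℝ :=
  if h : ∃ x : disk d, (φ.toFun x : Euc d) = y then
    φ.factor h.choose ^ (-((d : ℝ) + 2) / 2) * f h.choose
  else 0

theorem weight_coe (φ : ConfEmb d) (f : Euc d → ℝ) (x : disk d) :
    φ.weight f (φ.toFun x) = φ.factor x ^ (-((d : ℝ) + 2) / 2) * f x := by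
  have h : ∃ z : disk d, (φ.toFun z : Euc d) = φ.toFun x := ⟨x, rfl⟩
  rw [weight, dif_pos h, φ.isOpenEmbedding.injective (Subtype.ext h.choose_spec)]

theorem weight_of_forall_ne (φ : ConfEmb d) (f : Euc d → ℝ) (y : Euc d)
    (h : ∀ x : disk d, (φ.toFun x : Euc d) ≠ y) : φ.weight f y = 0 :=
  dif_neg fun ⟨x, hx⟩ => h x hx

/-- The image of the support of `f`. -/
def image (φ : ConfEmb d) (f : Test d) : Set (Euc d) := extend φ.toFun '' tsupport f

theorem isCompact_image (φ : ConfEmb d) (f : Test d) : IsCompact (φ.image f) :=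
  f.hasCompactSupport.isCompact.image_of_continuousOn
    (φ.smooth.continuousOn.mono f.tsupport_subset)

theorem image_subset (φ : ConfEmb d) (f : Test d) : φ.image f ⊆ disk d := by
  rintro _ ⟨x, hx, rfl⟩
  exact extend_mem _ (f.tsupport_subset hx)

theorem weight_eq_zero (φ : ConfEmb d) (f : Test d) {y : Euc d} (hy : y ∉ φ.image f) :
    φ.weight f y = 0 := by
  by_cases h : ∃ x : disk d, (φ.toFun x : Euc d) = y
  · obtain ⟨x, rfl⟩ := h
    rw [weight_coe]
    have : (x : Euc d) ∉ tsupport f := fun hx => hy ⟨x, hx, extend_coe _ _⟩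
    rw [image_eq_zero_of_notMem_tsupport this, mul_zero]
  · exact dif_neg h

theorem tsupport_weight (φ : ConfEmb d) (f : Test d) : tsupport (φ.weight f) ⊆ φ.image f :=
  closure_minimal (fun y hy => by
    by_contra h
    exact hy (φ.weight_eq_zero f h)) (φ.isCompact_image f).isClosed

theorem factor_spec (φ : ConfEmb d) : ContDiffOn ℝ ∞ φ.factor (disk d) ∧ ∀ x ∈ disk d,
    0 < φ.factor x ∧ ∀ u v : Euc d,
      inner ℝ (fderiv ℝ (extend φ.toFun) x u) (fderiv ℝ (extend φ.toFun) x v) =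
        φ.factor x ^ 2 * inner ℝ u v :=
  φ.conformal.choose_spec

theorem contDiff_weight (φ : ConfEmb d) (f : Test d) : ContDiff ℝ ∞ (φ.weight f) := by
  rw [contDiff_iff_contDiffAt]
  intro y
  by_cases hy : y ∈ φ.image f
  · obtain ⟨x, hx, rfl⟩ := hy
    have hxd : x ∈ disk d := f.tsupport_subset hx
    have hdet : (fderiv ℝ (extend φ.toFun) x).det ≠ 0 := (φ.orientation x hxd).ne'
    set f' := ContinuousLinearMap.toContinuousLinearEquivOfDetNeZero _ hdet with hf'
    have hf0 := φ.contDiffAt hxd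
    have hfd : HasFDerivAt (extend φ.toFun) (f' : Euc d →L[ℝ] Euc d) x :=
      (hf0.differentiableAt (by simp)).hasFDerivAt
    set e := hf0.toOpenPartialHomeomorph _ hfd (by simp) with he
    have hes : ∀ z, e z = extend φ.toFun z := fun z => rfl
    have hxs : x ∈ e.source := hf0.mem_toOpenPartialHomeomorph_source hfd (by simp)
    have hsm : ContDiffAt ℝ ∞ e.symm (e x) := hf0.to_localInverse hfd (by simp)
    have hex : e.symm (e x) = x := e.left_inv hxs
    have hev : φ.weight f =ᶠ[nhds (e x)] fun z =>
        φ.factor (e.symm z) ^ (-((d : ℝ) + 2) / 2) * f (e.symm z) := by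
      filter_upwards [e.open_target.mem_nhds (e.map_source hxs),
        hsm.continuousAt.preimage_mem_nhds (by rw [hex]; exact (disk d).2.mem_nhds hxd)]
        with z hz hz'
      have h1 := weight_coe φ f ⟨e.symm z, hz'⟩
      rwa [← extend_coe, ← hes, e.right_inv hz] at h1
    change ContDiffAt ℝ ∞ (φ.weight f) (e x)
    refine ContDiffAt.congr_of_eventuallyEq ?_ hev
    have hΩ : ContDiffAt ℝ ∞ φ.factor (e.symm (e x)) := by
      rw [hex]; exact φ.factor_spec.1.contDiffAt ((disk d).2.mem_nhds hxd)
    refine ContDiffAt.mul (ContDiffAt.rpow_const_of_ne (hΩ.comp _ hsm) ?_)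
      (f.contDiff.contDiffAt.comp _ hsm)
    simp only [hex]
    exact (φ.factor_spec.2 x hxd).1.ne'
  · have : φ.weight f =ᶠ[nhds y] fun _ => 0 := by
      filter_upwards [(φ.isCompact_image f).isClosed.isOpen_compl.mem_nhds hy] with z hz
      exact φ.weight_eq_zero f hz
    exact contDiffAt_const.congr_of_eventuallyEq this

/-- The map `W_φ : C_c^∞(𝔻) → C_c^∞(𝔻)`. -/
def W (φ : ConfEmb d) : Test d →ₗ[ℝ] Test d where
  toFun f :=
    { toFun := φ.weight f
      contDiff' := φ.contDiff_weight f
      hasCompactSupport' := (φ.isCompact_image f).of_isClosed_subset (isClosed_tsupport _)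
        (φ.tsupport_weight f)
      tsupport_subset' := (φ.tsupport_weight f).trans (φ.image_subset f) }
  map_add' f g := by
    ext y
    change φ.weight (⇑(f + g)) y = φ.weight f y + φ.weight g y
    by_cases h : ∃ x : disk d, (φ.toFun x : Euc d) = y
    · obtain ⟨x, rfl⟩ := h
      simp only [weight_coe, Test.add_apply, mul_add]
    · simp [weight, dif_neg h]
  map_smul' c f := by
    ext y
    change φ.weight (⇑(c • f)) y = c * φ.weight f y
    by_cases h : ∃ x : disk d, (φ.toFun x : Euc d) = y
    · obtain ⟨x, rfl⟩ := h
      simp only [weight_coe, Test.smul_apply]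
      ring
    · simp [weight, dif_neg h]

end ConfEmb

/-- The operad of conformal disk embeddings, `CE d (Fin n)` being its `n`-th space: conformal open
embeddings of a disjoint union of disks indexed by `ι` into the disk, that is, families of
conformal open embeddings with pairwise disjoint images. -/
structure CE (d : ℕ) (ι : Type) where
  emb : ι → ConfEmb d
  disjoint : Pairwise fun i j => Disjoint (range (emb i).toFun) (range (emb j).toFun)

namespace CE
/-- A conformal open embedding as a unary operation. -/
def ofConfEmb (φ : ConfEmb d) : CE d (Fin 1) where
  emb _ := φ
  disjoint _ _ h := absurd (Subsingleton.elim _ _) h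

/-- Operadic composition. -/
def comp {ι : Type} {κ : ι → Type} (φ : CE d ι) (ψ : ∀ i, CE d (κ i)) : CE d (Σ i, κ i) where
  emb s := φ.emb s.1 * (ψ s.1).emb s.2
  disjoint := by
    rintro ⟨i, k⟩ ⟨j, l⟩ h
    change Disjoint (range ((φ.emb i).toFun ∘ ((ψ i).emb k).toFun))
      (range ((φ.emb j).toFun ∘ ((ψ j).emb l).toFun))
    by_cases hij : i = j
    · subst hij
      rw [range_comp, range_comp, disjoint_image_iff (φ.emb i).isOpenEmbedding.injective]
      exact (ψ i).disjoint fun hkl => h (by rw [hkl])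
    · exact (φ.disjoint hij).mono (range_comp_subset_range _ _) (range_comp_subset_range _ _)

/-- Relabelling of the disks; for `ι = κ` this is the action of permutations. -/
def reindex {ι κ : Type} (σ : ι ≃ κ) (φ : CE d κ) : CE d ι where
  emb i := φ.emb (σ i)
  disjoint _ _ h := φ.disjoint (σ.injective.ne h)
end CE

end Analysis

section Observables
open SymmetricAlgebra TensorProduct
variable {d : ℕ}

theorem green_symm (x y : Euc d) : green (x, y) = green (y, x) := by
  simp [green, norm_sub_rev x y]

/-- The form `∂_{G_d}` on `C_c^∞(𝔻)`. -/
def greenPairing : Test d →ₗ[ℝ] Test d →ₗ[ℝ] ℝ := kernelPairing green locallyIntegrable_green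

theorem greenPairing_symm (f g : Test d) : greenPairing f g = greenPairing g f :=
  kernelPairing_symm green locallyIntegrable_green green_symm f g

/-- `P(C_c^∞(𝔻)) = Sym C_c^∞(𝔻)`. -/
abbrev PTest (d : ℕ) : Type := SymmetricAlgebra ℝ (Test d)

/-- The BV operator `Δ^BV` of the flat disk. -/
def bv (d : ℕ) : PTest d ⊗[ℝ] Test d →ₗ[ℝ] PTest d := bvOperator l2 lap

/-- The quantum observables `F_CL(𝔻)`, the cokernel of `Δ^BV`. -/
abbrev FCL (d : ℕ) : Type := PTest d ⧸ LinearMap.range (bv d)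

/-- The class in `F_CL(𝔻)` of a polynomial. -/
def toFCL : PTest d →ₗ[ℝ] FCL d := (LinearMap.range (bv d)).mkQ

/-- `S^cl(𝔻) = C_c^∞(𝔻) / Δ C_c^∞(𝔻)`. -/
abbrev Scl (d : ℕ) : Type := Test d ⧸ LinearMap.range (lap (d := d))

/-- The classical observables `P(S^cl(𝔻)) = Sym (C_c^∞(𝔻) / Δ C_c^∞(𝔻))`. -/
abbrev PScl (d : ℕ) : Type := SymmetricAlgebra ℝ (Scl d)

/-- The canonical projection `P(C_c^∞(𝔻)) → P(S^cl(𝔻))`. -/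
def toPScl : PTest d →ₐ[ℝ] PScl d := symMap (LinearMap.range (lap (d := d))).mkQ

/-- The generator `[f]` of `P(S^cl(𝔻))`. -/
def cls (f : Test d) : PScl d := ι ℝ (Scl d) ((LinearMap.range (lap (d := d))).mkQ f)

/-- `exp (∂_{G_d})` on `P(C_c^∞(𝔻))`. -/
def expGreen : PTest d →ₗ[ℝ] PTest d := expContraction greenPairing greenPairing_symm

/-- `W_φ^0 : f₁ ⋯ fₙ ↦ W_φ(f₁) ⋯ W_φ(fₙ)`. -/
def W0 (φ : ConfEmb d) : PTest d →ₐ[ℝ] PTest d := symMap φ.W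

/-- A family of operations `A^{⊗ι} → A` indexed by the operad. -/
abbrev Operations (d : ℕ) (A : Type) [AddCommGroup A] [Module ℝ A] : Type 1 :=
  ∀ (ι : Type) [Fintype ι], CE d ι → (⨂[ℝ] _ : ι, A) →ₗ[ℝ] A

/-- The axioms of an algebra over the operad `CE d`: unit, composition and equivariance. -/
def IsCEAlgebra {A : Type} [AddCommGroup A] [Module ℝ A] (ρ : Operations d A) : Prop :=
  (∀ a : A, ρ (Fin 1) (CE.ofConfEmb 1) (⨂ₜ[ℝ] _, a) = a) ∧
  (∀ (ι : Type) [Fintype ι] (κ : ι → Type) [∀ i, Fintype (κ i)] (φ : CE d ι)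
    (ψ : ∀ i, CE d (κ i)) (a : (Σ i, κ i) → A),
    ρ (Σ i, κ i) (φ.comp ψ) (⨂ₜ[ℝ] s, a s) =
      ρ ι φ (⨂ₜ[ℝ] i, ρ (κ i) (ψ i) (⨂ₜ[ℝ] k, a ⟨i, k⟩))) ∧
  (∀ (ι κ : Type) [Fintype ι] [Fintype κ] (σ : ι ≃ κ) (φ : CE d κ) (a : κ → A),
    ρ ι (φ.reindex σ) (⨂ₜ[ℝ] i, a (σ i)) = ρ κ φ (⨂ₜ[ℝ] k, a k))

/-- Transport of operations along a linear isomorphism `Ψ`: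
`Ψ ∘ F_φ ∘ (Ψ⁻¹ ⊗ ⋯ ⊗ Ψ⁻¹)`. -/
def transport {A B : Type} [AddCommGroup A] [Module ℝ A] [AddCommGroup B] [Module ℝ B]
    (Ψ : A ≃ₗ[ℝ] B) (F : Operations d A) : Operations d B :=
  fun ι _ φ => Ψ.toLinearMap ∘ₗ F ι φ ∘ₗ PiTensorProduct.map fun _ => Ψ.symm.toLinearMap

/-- Contraction patterns between the factors of `n` monomials of lengths `m 0, …, m (n-1)`: sets
of pairwise disjoint pairs of factors, each pair joining two different monomials. A pair is
written with its member from the earlier monomial first. -/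
def IsPattern {n : ℕ} {m : Fin n → ℕ}
    (C : Finset ((Σ i, Fin (m i)) × (Σ i, Fin (m i)))) : Prop :=
  (∀ p ∈ C, p.1.1 < p.2.1) ∧
  ∀ p ∈ C, ∀ q ∈ C, p ≠ q → p.1 ≠ q.1 ∧ p.1 ≠ q.2 ∧ p.2 ≠ q.1 ∧ p.2 ≠ q.2

open Classical in
/-- The contraction of the factors `g` along the pattern `C`: the product of `∂_{G_d}` over the
pairs in `C`, times the product of the classes of the factors that occur in no pair. -/
def wickTerm {n : ℕ} {m : Fin n → ℕ} (g : (Σ i, Fin (m i)) → Test d)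
    (C : Finset ((Σ i, Fin (m i)) × (Σ i, Fin (m i)))) : PScl d :=
  (∏ p ∈ C, greenPairing (g p.1) (g p.2)) •
    ∏ s with ∀ p ∈ C, s ≠ p.1 ∧ s ≠ p.2, cls (g s)

open Classical in
/-- The sum of all contractions with at least one pair. -/
def wickSum {n : ℕ} {m : Fin n → ℕ} (g : (Σ i, Fin (m i)) → Test d) : PScl d :=
  ∑ C : Finset ((Σ i, Fin (m i)) × (Σ i, Fin (m i))) with IsPattern C ∧ C.Nonempty, wickTerm g C

end Observables

end ConfFA
end

open ConfFA
open scoped TensorProduct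

noncomputable section
namespace ConfFA

/-! ### Exponentials of contractions on symmetric algebras. -/

section Algebra
open SymmetricAlgebra TensorProduct

variable {V : Type*} [AddCommGroup V] [Module ℝ V]

section Exp
variable (B : V →ₗ[ℝ] V →ₗ[ℝ] ℝ) (hB : ∀ f g, B f g = B g f)

/-! The commutator of `∂_B` with multiplication by `f` is the derivation `D_f` extending `g ↦ B(f,
g)`, and `D_f` commutes with `∂_B`. Hence `exp(∂_B)` turns multiplication by `f` into `f + D_f`
(`expContraction_ι_mul`). Green's function inverts the Laplacian, `G(f, Δh) = ∫ f h`
(`greenPairing_lap`), so this extra derivation cancels the one in the BV operator: `exp(∂_G)` sends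
`Δ^BV(x ⊗ h)` to `-Δh · exp(∂_G) x`. The image of the BV operator therefore goes onto the ideal
generated by the functions `Δh`, which is the kernel of the projection to `Sym S^cl`
(`map_range_bvOperator`). This gives the isomorphism `Ψ`.

Naturality comes from the conformal invariance of the Green pairing (`ConfEmb.greenPairing_W`). Its
source is Liouville's theorem in the form `‖φ x - φ y‖² = Ω(x) Ω(y) ‖x - y‖²`
(`IsConformalOn.norm_sub_sq`), proved without classifying conformal maps: with `ρ = 1 / Ω`, both `ρ`
and `ρ φ` have a constant multiple of the metric as second derivative, so their second order Taylor
expansions are exact, and `‖∇ρ‖² = 2cρ` turns them into the distance formula. The conformal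
covariance of the Laplacian, `W_φ Δ = Δ V_φ` with `V_φ` of the dual weight, is then obtained by
duality (`ConfEmb.W_lap`).

The `n`-ary products descend to the cokernel because the images are disjoint: `V_{φᵢ} h` is
orthogonal to the factors coming from the other disks, so the derivation in the BV operator does not
see them (`mul_W0_mem_range_bv`). The operad axioms then reduce to the functoriality of `W⁰` and the
commutativity of the product.

A monomial of classes has as preimage under `Ψ` the class of `exp(-∂_G)` of the monomial in
representatives. The structure map is thus `exp(∂_G)` applied to a product of normally ordered
groups, where contractions inside a group cancel and those between groups survive
(`expContraction_groupExp`). -/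

theorem contraction_pow_ι_mul (f : V) (x : SymmetricAlgebra ℝ V) (k : ℕ) :
    (contraction B hB ^ (k + 1)) (ι ℝ V f * x) =
      ι ℝ V f * (contraction B hB ^ (k + 1)) x +
        ((k : ℝ) + 1) • symDeriv (B f) ((contraction B hB ^ k) x) := by
  induction k with
  | zero => simp [contraction_ι_mul]
  | succ k ih =>
    rw [pow_succ', Module.End.mul_apply, ih, map_add, contraction_ι_mul, map_smul,
      contraction_symDeriv]
    simp only [← Module.End.mul_apply, ← pow_succ']
    push_cast
    module

theorem expContraction_eq_sum (x : SymmetricAlgebra ℝ V) (N : ℕ)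
    (hN : ∀ k, N ≤ k → (contraction B hB ^ k) x = 0) :
    expContraction B hB x =
      ∑ k ∈ Finset.range N, (k.factorial : ℝ)⁻¹ • (contraction B hB ^ k) x := by
  refine finsum_eq_sum_of_support_subset _ fun k hk => ?_
  by_contra h
  rw [Finset.coe_range, Set.mem_Iio, not_lt] at h
  exact hk (by simp [hN k h])

theorem expContraction_one : expContraction B hB 1 = 1 := by
  rw [expContraction_eq_sum B hB 1 1]
  · simp
  · intro k hk
    obtain ⟨k, rfl⟩ := Nat.exists_eq_add_of_le' hk
    rw [pow_succ, Module.End.mul_apply, contraction_one, map_zero]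

theorem contraction_pow_symDeriv (l : V →ₗ[ℝ] ℝ) (k : ℕ) (x : SymmetricAlgebra ℝ V) :
    (contraction B hB ^ k) (symDeriv l x) = symDeriv l ((contraction B hB ^ k) x) := by
  induction k with
  | zero => simp
  | succ k ih =>
    rw [pow_succ', Module.End.mul_apply, ih, contraction_symDeriv, Module.End.mul_apply]

theorem expContraction_symDeriv (l : V →ₗ[ℝ] ℝ) (x : SymmetricAlgebra ℝ V) :
    expContraction B hB (symDeriv l x) = symDeriv l (expContraction B hB x) := by
  obtain ⟨N, hN⟩ := contraction_locally_nilpotent B hB x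
  rw [expContraction_eq_sum B hB x N hN, expContraction_eq_sum B hB _ N, map_sum]
  · simp [contraction_pow_symDeriv]
  · intro k hk
    rw [contraction_pow_symDeriv, hN k hk, map_zero]

/-- Since `D_f = [∂_B, f]` commutes with `∂_B`, one has `[∂_Bᵏ, f] = k D_f ∂_Bᵏ⁻¹`, and dividing by
`k!` and summing gives `D_f exp(∂_B)`. All later statements on `exp(∂_B)` are inductions based on
this rule. -/
theorem expContraction_ι_mul (f : V) (x : SymmetricAlgebra ℝ V) :
    expContraction B hB (ι ℝ V f * x) =
      ι ℝ V f * expContraction B hB x + symDeriv (B f) (expContraction B hB x) := by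
  obtain ⟨N, hN⟩ := contraction_locally_nilpotent B hB x
  have h1 : ∀ k, N + 1 ≤ k → (contraction B hB ^ k) (ι ℝ V f * x) = 0 := by
    intro k hk
    obtain ⟨k, rfl⟩ := Nat.exists_eq_add_of_le' (le_trans (Nat.le_add_left 1 N) hk)
    rw [contraction_pow_ι_mul, hN _ (by omega), hN _ (by omega)]
    simp
  have h2 : symDeriv (B f) (expContraction B hB x) = ∑ k ∈ Finset.range N,
      (k.factorial : ℝ)⁻¹ • symDeriv (B f) ((contraction B hB ^ k) x) := by
    rw [expContraction_eq_sum B hB x N hN]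
    simp
  -- The term `k = 0` is split off, so that the remaining ones carry `(k + 1) / (k + 1)! = 1 / k!`.
  rw [expContraction_eq_sum B hB _ _ h1, h2,
    expContraction_eq_sum B hB x (N + 1) fun k hk => hN k (by omega),
    Finset.sum_range_succ', Finset.sum_range_succ', mul_add, Finset.mul_sum,
    add_right_comm, ← Finset.sum_add_distrib]
  congr 1
  · refine Finset.sum_congr rfl fun k _ => ?_
    rw [contraction_pow_ι_mul, smul_add, smul_smul, mul_smul_comm]
    congr 2
    rw [Nat.factorial_succ]
    push_cast
    field_simp
  · simp

/-- By induction on the number of factors: the two exponentials add the derivations of `B` and of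
`B' = -B`, which cancel. -/
theorem expContraction_add_eq_zero (B' : V →ₗ[ℝ] V →ₗ[ℝ] ℝ) (hB' : ∀ f g, B' f g = B' g f)
    (h : B + B' = 0) (x : SymmetricAlgebra ℝ V) :
    expContraction B hB (expContraction B' hB' x) = x := by
  have hf : ∀ f, B' f = -B f := fun f => by
    rw [eq_neg_iff_add_eq_zero, add_comm, ← LinearMap.add_apply, h, LinearMap.zero_apply]
  induction x using sym_induction_ι_mul with
  | one => simp [expContraction_one]
  | add x y hx hy => simp [hx, hy]
  | smul r x hx => simp [hx]
  | mul f x hx =>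
    rw [expContraction_ι_mul, map_add, expContraction_ι_mul, expContraction_symDeriv, hx, hf]
    have : symDeriv (-B f) x = -symDeriv (B f) x :=
      LinearMap.congr_fun (map_neg symDerivₗ (B f)) x
    rw [this]
    abel

/-- `exp (∂_B)` as a linear automorphism, with inverse `exp (∂_{-B})`. -/
def expContractionEquiv : SymmetricAlgebra ℝ V ≃ₗ[ℝ] SymmetricAlgebra ℝ V :=
  LinearEquiv.ofLinearMap (expContraction B hB)
    (expContraction (-B) fun f g => by simp [hB f g])
    (LinearMap.ext fun x => expContraction_add_eq_zero _ _ _ _ (by abel) x)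
    (LinearMap.ext fun x => expContraction_add_eq_zero _ _ _ _ (by abel) x)

theorem expContractionEquiv_apply (x : SymmetricAlgebra ℝ V) :
    expContractionEquiv B hB x = expContraction B hB x := rfl

variable {W : Type*} [AddCommGroup W] [Module ℝ W]

theorem symMap_ι (T : V →ₗ[ℝ] W) (f : V) : symMap T (ι ℝ V f) = ι ℝ W (T f) := by
  simp [symMap]

theorem symDeriv_symMap (T : V →ₗ[ℝ] W) (l : V →ₗ[ℝ] ℝ) (m : W →ₗ[ℝ] ℝ)
    (h : ∀ f, m (T f) = l f) (x : SymmetricAlgebra ℝ V) :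
    symDeriv m (symMap T x) = symMap T (symDeriv l x) := by
  induction x using SymmetricAlgebra.induction with
  | algebraMap r => simp [symDeriv_algebraMap, AlgHom.commutes]
  | ι x => simp [symDeriv_ι, symMap_ι, h, AlgHom.commutes]
  | mul a b ha hb => simp [symDeriv_mul, ha, hb]
  | add a b ha hb => simp [ha, hb]

theorem expContraction_symMap (T : V →ₗ[ℝ] W) (B' : W →ₗ[ℝ] W →ₗ[ℝ] ℝ)
    (hB' : ∀ f g, B' f g = B' g f) (h : ∀ f g, B' (T f) (T g) = B f g)
    (x : SymmetricAlgebra ℝ V) :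
    expContraction B' hB' (symMap T x) = symMap T (expContraction B hB x) := by
  induction x using sym_induction_ι_mul with
  | one => simp [expContraction_one]
  | add x y hx hy => simp [hx, hy]
  | smul r x hx => simp [hx]
  | mul f x hx =>
    rw [map_mul, symMap_ι, expContraction_ι_mul, expContraction_ι_mul, hx,
      symDeriv_symMap T (B f) (B' (T f)) (h f), map_add, map_mul, symMap_ι]

end Exp

/-! ### The image of the BV operator. -/

section BV
variable (B : V →ₗ[ℝ] V →ₗ[ℝ] ℝ) (L : V →ₗ[ℝ] V)

theorem bvOperator_tmul_apply (x : SymmetricAlgebra ℝ V) (h : V) :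
    bvOperator B L (x ⊗ₜ h) = symDeriv (B.flip h) x - ι ℝ V (L h) * x := by
  simp [bvOperator, symDerivₗ]

variable (G : V →ₗ[ℝ] V →ₗ[ℝ] ℝ) (hG : ∀ f g, G f g = G g f)

/-- Moving `exp(∂_G)` past multiplication by `L h` produces the derivation of `G(L h, ·) = B(·, h)`,
which is precisely the derivation term of the BV operator. -/
theorem expContraction_bvOperator (hGL : ∀ f h, G f (L h) = B f h)
    (x : SymmetricAlgebra ℝ V) (h : V) :
    expContraction G hG (bvOperator B L (x ⊗ₜ h)) =
      -(ι ℝ V (L h) * expContraction G hG x) := by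
  have : G (L h) = B.flip h := LinearMap.ext fun f => by rw [hG, hGL, LinearMap.flip_apply]
  rw [bvOperator_tmul_apply, map_sub, expContraction_symDeriv, expContraction_ι_mul, this]
  abel

/-- The kernel of `Sym V → Sym (V / K)` is the ideal generated by `K`. -/
theorem ker_symMap_mkQ (K : Submodule ℝ V) :
    RingHom.ker (symMap K.mkQ) = Ideal.span (ι ℝ V '' K) := by
  -- A linear section `s` of the projection `π` makes `Sym(s) ∘ Sym(π)` the identity modulo the
  -- ideal; an element killed by `Sym(π)` then lies in the ideal.
  obtain ⟨s, hs⟩ := K.mkQ.exists_rightInverse_of_surjective K.range_mkQ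
  have key : ∀ x, x - symMap s (symMap K.mkQ x) ∈ Ideal.span (ι ℝ V '' (K : Set V)) := by
    intro x
    induction x using SymmetricAlgebra.induction with
    | algebraMap r => simp [AlgHom.commutes]
    | ι x =>
      rw [symMap_ι, symMap_ι, ← map_sub]
      refine Ideal.subset_span ⟨_, ?_, rfl⟩
      refine (Submodule.Quotient.eq K).1 ?_
      exact (LinearMap.congr_fun hs (K.mkQ x)).symm
    | mul a b ha hb =>
      rw [map_mul, map_mul, show ∀ a b c e : SymmetricAlgebra ℝ V,
        a * b - c * e = b * (a - c) + c * (b - e) from fun a b c e => by ring]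
      exact Ideal.add_mem _ (Ideal.mul_mem_left _ _ ha) (Ideal.mul_mem_left _ _ hb)
    | add a b ha hb =>
      rw [map_add, map_add, add_sub_add_comm]
      exact Ideal.add_mem _ ha hb
  refine le_antisymm (fun x hx => ?_) (Ideal.span_le.2 ?_)
  · have := key x
    rwa [RingHom.mem_ker.1 hx, map_zero, sub_zero] at this
  · rintro _ ⟨f, hf, rfl⟩
    rw [SetLike.mem_coe, RingHom.mem_ker, symMap_ι,
      show K.mkQ f = 0 from (Submodule.Quotient.mk_eq_zero K).2 hf, map_zero]

theorem symMap_surjective {W : Type*} [AddCommGroup W] [Module ℝ W] (T : V →ₗ[ℝ] W)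
    (hT : Function.Surjective T) : Function.Surjective (symMap T) := by
  intro y
  induction y using SymmetricAlgebra.induction with
  | algebraMap r => exact ⟨algebraMap ℝ _ r, AlgHom.commutes _ _⟩
  | ι x =>
    obtain ⟨f, rfl⟩ := hT x
    exact ⟨_, symMap_ι T f⟩
  | mul a b ha hb =>
    obtain ⟨a, rfl⟩ := ha
    obtain ⟨b, rfl⟩ := hb
    exact ⟨a * b, map_mul _ _ _⟩
  | add a b ha hb =>
    obtain ⟨a, rfl⟩ := ha
    obtain ⟨b, rfl⟩ := hb
    exact ⟨a + b, map_add _ _ _⟩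

/-- `exp (∂_G)` identifies the image of the BV operator with the ideal generated by the image
of `L`. -/
theorem map_range_bvOperator (hGL : ∀ f h, G f (L h) = B f h) :
    (LinearMap.range (bvOperator B L)).map (expContractionEquiv G hG).toLinearMap =
      LinearMap.ker (symMap (LinearMap.range L).mkQ).toLinearMap := by
  apply le_antisymm
  · rw [Submodule.map_le_iff_le_comap]
    rintro _ ⟨z, rfl⟩
    induction z using TensorProduct.induction_on with
    | zero => simp
    | add a b ha hb => rw [map_add]; exact Submodule.add_mem _ ha hb
    | tmul x h =>
      rw [Submodule.mem_comap, LinearMap.mem_ker]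
      change symMap _ (expContraction G hG _) = 0
      rw [expContraction_bvOperator B L G hG hGL, map_neg, map_mul, symMap_ι]
      have : (LinearMap.range L).mkQ (L h) = 0 := (Submodule.Quotient.mk_eq_zero _).2 ⟨h, rfl⟩
      rw [this, map_zero, zero_mul, neg_zero]
  · intro x hx
    have hx' : x ∈ Ideal.span (ι ℝ V '' (LinearMap.range L : Set V)) := by
      rw [← ker_symMap_mkQ]; exact hx
    clear hx
    induction hx' using Submodule.span_induction with
    | mem x h =>
      obtain ⟨_, ⟨h, rfl⟩, rfl⟩ := h
      refine ⟨_, ⟨-(1 ⊗ₜ h), rfl⟩, ?_⟩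
      change expContraction G hG _ = _
      rw [map_neg, map_neg, expContraction_bvOperator B L G hG hGL, expContraction_one]
      simp
    | zero => exact Submodule.zero_mem _
    | add x y _ _ hx hy => exact Submodule.add_mem _ hx hy
    | smul a x hx' hx =>
      obtain ⟨_, ⟨z, rfl⟩, rfl⟩ := hx
      clear hx'
      induction z using TensorProduct.induction_on with
      | zero => simp
      | add y z hy hz => rw [map_add, map_add, smul_add]; exact Submodule.add_mem _ hy hz
      | tmul y h =>
        -- `exp(∂_G)` is not multiplicative, so the factor `a` is absorbed by taking the preimage of
        -- the whole product `a · exp(∂_G) y`.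
        refine ⟨_, ⟨(expContractionEquiv G hG).symm (a * expContraction G hG y) ⊗ₜ h, rfl⟩, ?_⟩
        change expContraction G hG _ = a • expContraction G hG _
        rw [expContraction_bvOperator B L G hG hGL, expContraction_bvOperator B L G hG hGL,
          ← expContractionEquiv_apply G hG, LinearEquiv.apply_symm_apply, smul_eq_mul]
        ring

end BV
end Algebra

/-! ### Wick's theorem for groups of normally ordered factors. -/

section Wick
open SymmetricAlgebra

variable {V : Type*} [AddCommGroup V] [Module ℝ V]

theorem symDeriv_one (l : V →ₗ[ℝ] ℝ) : symDeriv l 1 = 0 := by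
  have := symDeriv_algebraMap l 1
  rwa [map_one] at this

theorem symDeriv_finset_prod {J : Type*} [DecidableEq J] (l : V →ₗ[ℝ] ℝ) (A : Finset J)
    (F : J → SymmetricAlgebra ℝ V) :
    symDeriv l (∏ t ∈ A, F t) = ∑ t ∈ A, symDeriv l (F t) * ∏ u ∈ A.erase t, F u := by
  induction A using Finset.induction_on with
  | empty => simp [symDeriv_one]
  | insert s A hs ih =>
    rw [Finset.prod_insert hs, symDeriv_mul, ih, Finset.sum_insert hs, Finset.erase_insert hs,
      Finset.mul_sum, add_comm]
    congr 1
    refine Finset.sum_congr rfl fun t ht => ?_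
    rw [Finset.erase_insert_of_ne (ne_of_mem_of_not_mem ht hs).symm, Finset.prod_insert (by simp [hs])]
    ring

variable {S I : Type*} [DecidableEq S] [Fintype I] [LinearOrder I]
variable (B : V →ₗ[ℝ] V →ₗ[ℝ] ℝ) (hB : ∀ f g, B f g = B g f) (γ : S → I) (g : S → V)

/-- The product over the groups `i` of `exp (∂_B)` applied to the product of the factors of
group `i` in `A`. -/
def groupExp (A : Finset S) : SymmetricAlgebra ℝ V :=
  ∏ i, expContraction B hB (∏ s ∈ A with γ s = i, ι ℝ V (g s))

omit [DecidableEq S] in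
theorem groupExp_eq (A : Finset S) (i : I) : groupExp B hB γ g A =
    expContraction B hB (∏ s ∈ A with γ s = i, ι ℝ V (g s)) *
      ∏ j ∈ Finset.univ.erase i, expContraction B hB (∏ s ∈ A with γ s = j, ι ℝ V (g s)) :=
  (Finset.mul_prod_erase _ _ (Finset.mem_univ i)).symm

theorem symDeriv_prod_ι (l : V →ₗ[ℝ] ℝ) (A : Finset S) :
    symDeriv l (∏ s ∈ A, ι ℝ V (g s)) =
      ∑ t ∈ A, l (g t) • ∏ s ∈ A.erase t, ι ℝ V (g s) := by
  rw [symDeriv_finset_prod]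
  exact Finset.sum_congr rfl fun t _ => by rw [symDeriv_ι, Algebra.smul_def]

/-- Differentiating only the factors of group `i`. -/
theorem symDeriv_group (l : V →ₗ[ℝ] ℝ) (A : Finset S) (i : I) :
    symDeriv l (expContraction B hB (∏ s ∈ A with γ s = i, ι ℝ V (g s))) *
        ∏ j ∈ Finset.univ.erase i, expContraction B hB (∏ s ∈ A with γ s = j, ι ℝ V (g s)) =
      ∑ t ∈ A with γ t = i, l (g t) • groupExp B hB γ g (A.erase t) := by
  rw [← expContraction_symDeriv, symDeriv_prod_ι, map_sum, Finset.sum_mul]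
  refine Finset.sum_congr rfl fun t ht => ?_
  rw [Finset.mem_filter] at ht
  rw [map_smul, smul_mul_assoc, groupExp_eq B hB γ g _ i, Finset.filter_erase]
  congr 2
  refine Finset.prod_congr rfl fun j hj => ?_
  rw [Finset.filter_erase, Finset.erase_eq_of_notMem]
  rw [Finset.mem_filter, ht.2]
  exact fun h => Finset.ne_of_mem_erase hj h.2.symm

/-- The derivation passes through each exponential, so the Leibniz rule removes one factor at a
time, group by group. -/
theorem symDeriv_groupExp (l : V →ₗ[ℝ] ℝ) (A : Finset S) :
    symDeriv l (groupExp B hB γ g A) = ∑ t ∈ A, l (g t) • groupExp B hB γ g (A.erase t) := by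
  rw [groupExp, symDeriv_finset_prod]
  simp_rw [symDeriv_group]
  exact Finset.sum_fiberwise _ _ _

theorem groupExp_insert {A : Finset S} {s : S} (hs : s ∉ A) :
    groupExp B hB γ g (insert s A) = ι ℝ V (g s) * groupExp B hB γ g A +
      ∑ t ∈ A with γ t = γ s, B (g s) (g t) • groupExp B hB γ g (A.erase t) := by
  rw [← symDeriv_group B hB γ g (B (g s)) A (γ s), groupExp_eq B hB γ g _ (γ s),
    groupExp_eq B hB γ g A (γ s), Finset.filter_insert, if_pos rfl,
    Finset.prod_insert (by simp [hs]), expContraction_ι_mul, add_mul, mul_assoc]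
  congr 2
  · congr 1
    refine Finset.prod_congr rfl fun j hj => ?_
    rw [Finset.filter_insert, if_neg (Finset.ne_of_mem_erase hj).symm]
  · refine Finset.prod_congr rfl fun j hj => ?_
    rw [Finset.filter_insert, if_neg (Finset.ne_of_mem_erase hj).symm]

/-- The generating recursion of the Wick expansion. -/
theorem expContraction_groupExp_insert (B' : V →ₗ[ℝ] V →ₗ[ℝ] ℝ) (hB' : ∀ f g, B' f g = B' g f)
    (h : B' = -B) {A : Finset S} {s : S} (hs : s ∉ A) :
    expContraction B hB (groupExp B' hB' γ g (insert s A)) =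
      ι ℝ V (g s) * expContraction B hB (groupExp B' hB' γ g A) +
      ∑ t ∈ A with γ t ≠ γ s,
        B (g s) (g t) • expContraction B hB (groupExp B' hB' γ g (A.erase t)) := by
  subst h
  -- The outer exponential contracts `s` with every remaining factor, the inner one subtracts the
  -- contractions inside the group of `s`; only the other groups are left.
  rw [groupExp_insert _ _ _ _ hs, map_add, expContraction_ι_mul, ← expContraction_symDeriv,
    symDeriv_groupExp, ← Finset.sum_filter_add_sum_filter_not A (fun t => γ t = γ s)]
  simp only [map_sum, map_add, map_smul, LinearMap.neg_apply, neg_smul, map_neg,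
    Finset.sum_neg_distrib]
  abel

/-- Sets of pairwise disjoint pairs in `A`, each joining two different groups. -/
def IsGroupPattern (A : Finset S) (C : Finset (S × S)) : Prop :=
  (∀ p ∈ C, γ p.1 < γ p.2 ∧ p.1 ∈ A ∧ p.2 ∈ A) ∧
  ∀ p ∈ C, ∀ q ∈ C, p ≠ q → p.1 ≠ q.1 ∧ p.1 ≠ q.2 ∧ p.2 ≠ q.1 ∧ p.2 ≠ q.2

/-- The term of the Wick expansion attached to a set of pairs. -/
def groupTerm (A : Finset S) (C : Finset (S × S)) : SymmetricAlgebra ℝ V :=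
  (∏ p ∈ C, B (g p.1) (g p.2)) • ∏ s ∈ A with ∀ p ∈ C, s ≠ p.1 ∧ s ≠ p.2, ι ℝ V (g s)

open Classical in
/-- The sum over all contraction patterns in `A`. -/
def groupSum (A : Finset S) : SymmetricAlgebra ℝ V :=
  ∑ C ∈ (A ×ˢ A).powerset with IsGroupPattern γ A C, groupTerm B g A C

omit [DecidableEq S] [Fintype I] in
theorem IsGroupPattern.subset {A : Finset S} {C : Finset (S × S)} (h : IsGroupPattern γ A C) :
    C ⊆ A ×ˢ A := fun p hp => Finset.mem_product.2 (h.1 p hp).2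

-- Patterns are sorted by whether `s` occurs. As `s` lies in a largest group, it can only be the
-- second member of a pair, which matches the recursion satisfied by the exponential.
omit [Fintype I] in
theorem groupSum_insert {A : Finset S} {s : S} (hs : s ∉ A) (hmax : ∀ t ∈ A, γ t ≤ γ s) :
    groupSum B γ g (insert s A) = ι ℝ V (g s) * groupSum B γ g A +
      ∑ t ∈ A with γ t ≠ γ s, B (g t) (g s) • groupSum B γ g (A.erase t) := by
  classical
  have hlt : ∀ t ∈ A.filter (fun t => γ t ≠ γ s), γ t < γ s := fun t ht =>
    lt_of_le_of_ne (hmax t (Finset.mem_filter.1 ht).1) (Finset.mem_filter.1 ht).2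
  rw [groupSum, ← Finset.sum_filter_add_sum_filter_not _ (fun C => ∀ p ∈ C, p.2 ≠ s)]
  congr 1
  · rw [groupSum, Finset.mul_sum]
    refine Finset.sum_congr ?_ fun C hC => ?_
    · ext C
      simp only [Finset.mem_filter, Finset.mem_powerset]
      constructor
      · rintro ⟨⟨h1, h2⟩, h3⟩
        have : IsGroupPattern γ A C := by
          refine ⟨fun p hp => ?_, h2.2⟩
          obtain ⟨h4, h5, h6⟩ := h2.1 p hp
          have h7 : p.2 ∈ A := (Finset.mem_insert.1 h6).resolve_left (h3 p hp)
          -- As a first member, `s` would have a partner in a strictly larger group.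
          refine ⟨h4, (Finset.mem_insert.1 h5).resolve_left fun h => ?_, h7⟩
          rw [h] at h4
          exact absurd (hmax _ h7) (not_le.2 h4)
        exact ⟨this.subset, this⟩
      · rintro ⟨h1, h2⟩
        have : IsGroupPattern γ (insert s A) C :=
          ⟨fun p hp => ⟨(h2.1 p hp).1, Finset.mem_insert_of_mem (h2.1 p hp).2.1,
            Finset.mem_insert_of_mem (h2.1 p hp).2.2⟩, h2.2⟩
        exact ⟨⟨this.subset, this⟩, fun p hp h => hs (h ▸ (h2.1 p hp).2.2)⟩
    · have hC' := (Finset.mem_filter.1 hC).2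
      rw [groupTerm, groupTerm, Finset.filter_insert, if_pos, Finset.prod_insert (by simp [hs]),
        mul_smul_comm]
      exact fun p hp => ⟨fun h => hs (h ▸ (hC'.1 p hp).2.1), fun h => hs (h ▸ (hC'.1 p hp).2.2)⟩
  · simp_rw [groupSum, Finset.smul_sum]
    rw [Finset.sum_sigma']
    have hnot : ∀ t ∈ A, ∀ C, IsGroupPattern γ (A.erase t) C → ∀ p ∈ C,
        (p.1 ∈ A ∧ p.1 ≠ t ∧ p.1 ≠ s) ∧ (p.2 ∈ A ∧ p.2 ≠ t ∧ p.2 ≠ s) := by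
      intro t ht C hC p hp
      obtain ⟨_, h1, h2⟩ := hC.1 p hp
      rw [Finset.mem_erase] at h1 h2
      exact ⟨⟨h1.2, h1.1, fun h => hs (h ▸ h1.2)⟩, ⟨h2.2, h2.1, fun h => hs (h ▸ h2.2)⟩⟩
    symm
    -- A pattern involving `s` has exactly one pair `(t, s)`; deleting it leaves a pattern on
    -- `A.erase t`.
    refine Finset.sum_bij (fun (x : Σ _ : S, Finset (S × S)) _ => insert (x.1, s) x.2)
      ?_ ?_ ?_ ?_
    · rintro ⟨t, C⟩ hx
      simp only [Finset.mem_sigma] at hx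
      obtain ⟨ht, hC⟩ := hx
      have hlt' := hlt t ht
      rw [Finset.mem_filter] at ht hC
      have hn := hnot t ht.1 C hC.2
      have hts : t ≠ s := fun h => hs (h ▸ ht.1)
      have : IsGroupPattern γ (insert s A) (insert (t, s) C) := by
        refine ⟨fun p hp => ?_, fun p hp q hq hpq => ?_⟩
        · rcases Finset.mem_insert.1 hp with rfl | hp
          · exact ⟨hlt', Finset.mem_insert_of_mem ht.1, Finset.mem_insert_self _ _⟩
          · exact ⟨(hC.2.1 p hp).1, Finset.mem_insert_of_mem (hn p hp).1.1,
              Finset.mem_insert_of_mem (hn p hp).2.1⟩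
        · rcases Finset.mem_insert.1 hp with rfl | hp <;> rcases Finset.mem_insert.1 hq with rfl | hq
          · exact absurd rfl hpq
          · exact ⟨(hn q hq).1.2.1.symm, (hn q hq).2.2.1.symm, (hn q hq).1.2.2.symm,
              (hn q hq).2.2.2.symm⟩
          · exact ⟨(hn p hp).1.2.1, (hn p hp).1.2.2, (hn p hp).2.2.1, (hn p hp).2.2.2⟩
          · exact hC.2.2 p hp q hq hpq
      simp only [Finset.mem_filter, Finset.mem_powerset]
      exact ⟨⟨this.subset, this⟩, fun h => h (t, s) (Finset.mem_insert_self _ _) rfl⟩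
    · rintro ⟨t, C⟩ hx ⟨t', C'⟩ hx' h
      simp only [Finset.mem_sigma, Finset.mem_filter] at hx hx'
      have hn := hnot t hx.1.1 C hx.2.2
      have hn' := hnot t' hx'.1.1 C' hx'.2.2
      simp only at h
      have h1 : (t, s) ∈ insert (t', s) C' := h ▸ Finset.mem_insert_self _ _
      have h2 : t = t' := by
        rcases Finset.mem_insert.1 h1 with h2 | h2
        · exact congrArg Prod.fst h2
        · exact absurd rfl (hn' _ h2).2.2.2
      subst h2
      have h3 : C = C' := by
        rw [← Finset.erase_insert (a := (t, s)) (s := C) fun h => (hn _ h).2.2.2 rfl, h,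
          Finset.erase_insert fun h => (hn' _ h).2.2.2 rfl]
      rw [h3]
    · intro C hC
      simp only [Finset.mem_filter, Finset.mem_powerset] at hC
      obtain ⟨⟨-, hC⟩, h⟩ := hC
      push Not at h
      obtain ⟨⟨t, s'⟩, hp, rfl⟩ := h
      obtain ⟨h1, h2, -⟩ := hC.1 _ hp
      simp only at h1 h2 hs hmax hlt ⊢
      have hts : t ≠ s' := fun h => by rw [h] at h1; exact lt_irrefl _ h1
      have htA : t ∈ A := (Finset.mem_insert.1 h2).resolve_left hts
      refine ⟨⟨t, C.erase (t, s')⟩, ?_, Finset.insert_erase hp⟩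
      have : IsGroupPattern γ (A.erase t) (C.erase (t, s')) := by
        refine ⟨fun p hp' => ?_, fun p hp' q hq' => hC.2 p (Finset.mem_of_mem_erase hp') q
          (Finset.mem_of_mem_erase hq')⟩
        have h3 := Finset.mem_of_mem_erase hp'
        obtain ⟨h4, h5, h6⟩ := hC.1 p h3
        obtain ⟨h7, h8, h9, h10⟩ := hC.2 p h3 _ hp (Finset.ne_of_mem_erase hp')
        exact ⟨h4, Finset.mem_erase.2 ⟨h7, (Finset.mem_insert.1 h5).resolve_left h8⟩,
          Finset.mem_erase.2 ⟨h9, (Finset.mem_insert.1 h6).resolve_left h10⟩⟩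
      simp only [Finset.mem_sigma, Finset.mem_filter, Finset.mem_powerset]
      exact ⟨⟨htA, h1.ne⟩, this.subset, this⟩
    · rintro ⟨t, C⟩ hx
      simp only [Finset.mem_sigma, Finset.mem_filter] at hx
      have hn := hnot t hx.1.1 C hx.2.2
      have hts : t ≠ s := fun h => hs (h ▸ hx.1.1)
      simp only
      rw [groupTerm, groupTerm, Finset.prod_insert fun h => (hn _ h).2.2.2 rfl, smul_smul]
      congr 2
      ext u
      simp only [Finset.mem_filter, Finset.mem_erase, Finset.mem_insert, forall_eq_or_imp]
      constructor
      · rintro ⟨⟨h1, h2⟩, h3⟩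
        exact ⟨.inr h2, ⟨h1, fun h => hs (h ▸ h2)⟩, h3⟩
      · rintro ⟨h1, ⟨h2, h3⟩, h4⟩
        exact ⟨⟨h2, h1.resolve_left h3⟩, h4⟩

/-- **Wick's theorem**: the factors of each group being normally ordered, only contractions
between different groups contribute. -/
theorem expContraction_groupExp (B' : V →ₗ[ℝ] V →ₗ[ℝ] ℝ) (hB' : ∀ f g, B' f g = B' g f)
    (h : B' = -B) (A : Finset S) :
    expContraction B hB (groupExp B' hB' γ g A) = groupSum B γ g A := by
  classical
  induction A using Finset.strongInduction with
  | H A ih =>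
    rcases A.eq_empty_or_nonempty with rfl | hA
    · rw [groupSum, show ((∅ : Finset S) ×ˢ (∅ : Finset S)).powerset = {∅} by simp,
        Finset.filter_singleton, if_pos ⟨by simp, by simp⟩]
      simp [groupExp, groupTerm, expContraction_one]
    -- Both sides satisfy the same recursion on removal of a factor from a largest group, and it
    -- involves only strictly smaller sets.
    · obtain ⟨s, hs, hmax⟩ := A.exists_max_image γ hA
      have h1 : s ∉ A.erase s := Finset.notMem_erase s A
      have h2 : A.erase s ⊂ A := Finset.erase_ssubset hs
      have h3 := expContraction_groupExp_insert B hB γ g B' hB' h h1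
      have h4 := groupSum_insert B γ g h1 fun t ht => hmax t (Finset.mem_of_mem_erase ht)
      rw [Finset.insert_erase hs] at h3 h4
      rw [h3, h4, ih _ h2]
      congr 1
      refine Finset.sum_congr rfl fun t _ => ?_
      rw [ih _ (lt_of_le_of_lt (Finset.erase_subset _ _) h2), hB]

end Wick

/-! ### The Newtonian kernel as a fundamental solution. -/

section Green
open Set MeasureTheory TopologicalSpace Filter
open scoped ContDiff Topology
variable {d : ℕ}

/-- The standard basis vector. -/
abbrev stdVec (i : Fin d) : Euc d := EuclideanSpace.single i (1 : ℝ)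

theorem laplacian_eq_sum_fderiv {f : Euc d → ℝ} {x : Euc d} (hf : ContDiffAt ℝ 2 f x) :
    Laplacian.laplacian f x =
      ∑ i, fderiv ℝ (fun y => fderiv ℝ f y (stdVec i)) x (stdVec i) := by
  rw [InnerProductSpace.laplacian_eq_iteratedFDeriv_orthonormalBasis f
    (EuclideanSpace.basisFun (Fin d) ℝ)]
  refine Finset.sum_congr rfl fun i _ => ?_
  have h : DifferentiableAt ℝ (fderiv ℝ f) x :=
    (hf.fderiv_right (m := 1) (by norm_num)).differentiableAt (by simp)
  rw [iteratedFDeriv_two_apply, fderiv_clm_apply h (differentiableAt_const _)]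
  simp

theorem contDiff_fderiv_apply {f : Euc d → ℝ} (hf : ContDiff ℝ ∞ f) (v : Euc d) :
    ContDiff ℝ ∞ fun y => fderiv ℝ f y v :=
  (hf.fderiv_right (m := ∞) (by norm_cast)).clm_apply contDiff_const

theorem integral_mul_fderiv_of_hasCompactSupport {f u : Euc d → ℝ} (hf : ContDiff ℝ ∞ f)
    (hu : ContDiff ℝ ∞ u) (hc : HasCompactSupport u) (v : Euc d) :
    ∫ x, f x * fderiv ℝ u x v = -∫ x, fderiv ℝ f x v * u x := by
  have hf' := (contDiff_fderiv_apply hf v).continuous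
  have hu' := (contDiff_fderiv_apply hu v).continuous
  have hc' : HasCompactSupport fun x => fderiv ℝ u x v := hc.fderiv_apply ℝ v
  refine integral_mul_fderiv_eq_neg_fderiv_mul_of_integrable ?_ ?_ ?_
    (fun x _ => hf.differentiable (by simp) x) (fun x _ => hu.differentiable (by simp) x)
  · exact (hf'.mul hu.continuous).integrable_of_hasCompactSupport hc.mul_left
  · exact (hf.continuous.mul hu').integrable_of_hasCompactSupport hc'.mul_left
  · exact (hf.continuous.mul hu.continuous).integrable_of_hasCompactSupport hc.mul_left

/-- Two integrations by parts. Compact support is needed only for `u`, so `f` may be the regularized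
kernel. -/
theorem integral_mul_laplacian {f u : Euc d → ℝ} (hf : ContDiff ℝ ∞ f)
    (hu : ContDiff ℝ ∞ u) (hc : HasCompactSupport u) :
    ∫ x, f x * Laplacian.laplacian u x = ∫ x, Laplacian.laplacian f x * u x := by
  have h2 : ∀ {g : Euc d → ℝ}, ContDiff ℝ ∞ g → ∀ x, ContDiffAt ℝ 2 g x := fun hg x =>
    (hg.of_le (by norm_cast)).contDiffAt
  simp_rw [laplacian_eq_sum_fderiv (h2 hf _), laplacian_eq_sum_fderiv (h2 hu _),
    Finset.mul_sum, Finset.sum_mul]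
  rw [integral_finsetSum, integral_finsetSum]
  · refine Finset.sum_congr rfl fun i _ => ?_
    rw [integral_mul_fderiv_of_hasCompactSupport hf (contDiff_fderiv_apply hu _)
      (hc.fderiv_apply ℝ _), integral_mul_fderiv_of_hasCompactSupport
      (contDiff_fderiv_apply hf _) hu hc, neg_neg]
  · exact fun i _ => ((contDiff_fderiv_apply (contDiff_fderiv_apply hf _) _).continuous.mul
      hu.continuous).integrable_of_hasCompactSupport hc.mul_left
  · exact fun i _ => (hf.continuous.mul (contDiff_fderiv_apply (contDiff_fderiv_apply hu _)
      _).continuous).integrable_of_hasCompactSupport ((hc.fderiv_apply ℝ _).fderiv_apply ℝ _).mul_left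

theorem contDiff_regularized {ε : ℝ} (hε : 0 < ε) (p : ℝ) :
    ContDiff ℝ ∞ fun z : Euc d => (‖z‖ ^ 2 + ε ^ 2) ^ p :=
  ((contDiff_norm_sq ℝ).add contDiff_const).rpow_const_of_ne fun z => by positivity

theorem fderiv_regularized {ε : ℝ} (hε : 0 < ε) (p : ℝ) (z v : Euc d) :
    fderiv ℝ (fun z : Euc d => (‖z‖ ^ 2 + ε ^ 2) ^ p) z v =
      2 * p * (‖z‖ ^ 2 + ε ^ 2) ^ (p - 1) * inner ℝ z v := by
  have h1 : HasFDerivAt (fun z : Euc d => ‖z‖ ^ 2 + ε ^ 2) (2 • innerSL ℝ z) z :=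
    (hasStrictFDerivAt_norm_sq z).hasFDerivAt.add_const _
  rw [(h1.rpow_const (p := p) (.inl (by positivity))).fderiv]
  simp
  ring

theorem laplacian_regularized {ε : ℝ} (hε : 0 < ε) (p : ℝ) (z : Euc d) :
    Laplacian.laplacian (fun z : Euc d => (‖z‖ ^ 2 + ε ^ 2) ^ p) z =
      2 * p * (‖z‖ ^ 2 + ε ^ 2) ^ (p - 2) *
        (d * (‖z‖ ^ 2 + ε ^ 2) + 2 * (p - 1) * ‖z‖ ^ 2) := by
  have hpos : 0 < ‖z‖ ^ 2 + ε ^ 2 := by positivity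
  rw [laplacian_eq_sum_fderiv ((contDiff_regularized hε p).of_le (by norm_cast)).contDiffAt]
  have key : ∀ i : Fin d, fderiv ℝ (fun y : Euc d =>
      fderiv ℝ (fun z : Euc d => (‖z‖ ^ 2 + ε ^ 2) ^ p) y (stdVec i)) z (stdVec i) =
      2 * p * (‖z‖ ^ 2 + ε ^ 2) ^ (p - 2) * ((‖z‖ ^ 2 + ε ^ 2) + 2 * (p - 1) * z i ^ 2) := by
    intro i
    simp_rw [fderiv_regularized hε]
    have h1 : DifferentiableAt ℝ (fun z : Euc d => 2 * p * (‖z‖ ^ 2 + ε ^ 2) ^ (p - 1)) z :=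
      ((contDiff_regularized hε (p - 1)).differentiable (by simp) z).const_mul _
    have h2 : HasFDerivAt (fun y : Euc d => inner ℝ y (stdVec i)) (innerSL ℝ (stdVec i)) z := by
      simp_rw [real_inner_comm (stdVec i)]
      exact (innerSL ℝ (stdVec i)).hasFDerivAt
    rw [fderiv_fun_mul h1 h2.differentiableAt, h2.fderiv, fderiv_const_mul
      ((contDiff_regularized hε (p - 1)).differentiable (by simp) z)]
    simp only [add_apply, smul_apply, smul_eq_mul,
      fderiv_regularized hε, innerSL_apply_apply]
    have h3 : inner ℝ z (stdVec i) = z i := by simp [stdVec, EuclideanSpace.inner_single_right]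
    have h4 : inner ℝ (stdVec i) (stdVec i) = (1 : ℝ) := by simp [stdVec]
    rw [h3, h4, show p - 1 = p - 2 + 1 by ring, Real.rpow_add_one hpos.ne']
    ring_nf
  rw [Finset.sum_congr rfl fun i _ => key i, ← Finset.mul_sum, Finset.sum_add_distrib,
    ← Finset.mul_sum, ← EuclideanSpace.real_norm_sq_eq, Finset.sum_const, Finset.card_univ, Fintype.card_fin,
    nsmul_eq_mul]

/-- For `p = -(d - 2) / 2` one has `d + 2 (p - 1) = 0`: the terms in `‖z‖²` cancel and only those
with the factor `ε²` remain, a multiple of an approximate identity. -/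
theorem laplacian_newtonian {ε : ℝ} (hε : 0 < ε) (z : Euc d) :
    Laplacian.laplacian (fun z : Euc d => (‖z‖ ^ 2 + ε ^ 2) ^ (-((d : ℝ) - 2) / 2)) z =
      -((d : ℝ) - 2) * d * (ε ^ 2 * (‖z‖ ^ 2 + ε ^ 2) ^ (-((d : ℝ) + 2) / 2)) := by
  rw [laplacian_regularized hε, show -((d : ℝ) - 2) / 2 - 2 = -((d : ℝ) + 2) / 2 by ring]
  ring

theorem integral_one_add_norm_sq (hd : 3 ≤ d) :
    ∫ z : Euc d, (1 + ‖z‖ ^ 2) ^ (-((d : ℝ) + 2) / 2) = sphereVol d / d := by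
  have : Nonempty (Fin d) := ⟨⟨0, by omega⟩⟩
  have hd0 : (d : ℝ) ≠ 0 := by positivity
  rw [integral_fun_norm_addHaar volume (fun y => (1 + y ^ 2) ^ (-((d : ℝ) + 2) / 2)), sphereVol,
    Measure.toSphere_real_apply_univ]
  have key : ∫ y in Ioi (0 : ℝ), y ^ (d - 1) * (1 + y ^ 2) ^ (-((d : ℝ) + 2) / 2) =
      1 / (d : ℝ) - (0 : ℝ) ^ d * (1 + (0 : ℝ) ^ 2) ^ (-(d : ℝ) / 2) / d := by
    -- In polar coordinates the integrand has an explicit antiderivative, vanishing at `0` and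
    -- tending to `1 / d` at infinity.
    refine integral_Ioi_of_hasDerivAt_of_nonneg'
      (g := fun y => y ^ d * (1 + y ^ 2) ^ (-(d : ℝ) / 2) / d) (fun y hy => ?_) (fun y hy => ?_) ?_
    · have hpos : 0 < 1 + y ^ 2 := by positivity
      have h1 : HasDerivAt (fun y : ℝ => 1 + y ^ 2) (2 * y) y := by
        simpa using (hasDerivAt_pow 2 y).const_add 1
      have h2 := ((hasDerivAt_pow d y).mul
        (h1.rpow_const (p := -(d : ℝ) / 2) (.inl hpos.ne'))).div_const (d : ℝ)
      refine h2.congr_deriv ?_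
      rw [show -(d : ℝ) / 2 - 1 = -((d : ℝ) + 2) / 2 by ring,
        show -(d : ℝ) / 2 = -((d : ℝ) + 2) / 2 + 1 by ring, Real.rpow_add_one hpos.ne']
      obtain ⟨k, rfl⟩ := Nat.exists_eq_add_of_le' (show 1 ≤ d by omega)
      rw [Nat.add_sub_cancel]
      push_cast at hd0 ⊢
      field_simp
      ring
    · have : (0 : ℝ) < y := hy
      positivity
    · have h1 : Tendsto (fun y : ℝ => ((y ^ 2)⁻¹ + 1) ^ (-(d : ℝ) / 2) / d) atTop
          (𝓝 ((0 + 1) ^ (-(d : ℝ) / 2) / d)) := by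
        refine Tendsto.div_const (Tendsto.rpow_const ?_ (.inl (by norm_num))) _
        exact ((tendsto_pow_atTop two_ne_zero).inv_tendsto_atTop).add_const 1
      rw [zero_add, Real.one_rpow] at h1
      refine h1.congr' ?_
      filter_upwards [eventually_gt_atTop 0] with y hy
      have h2 : (y ^ 2)⁻¹ + 1 = (1 + y ^ 2) * (y ^ 2)⁻¹ := by field_simp
      have h3 : ((y ^ 2)⁻¹) ^ (-(d : ℝ) / 2) = y ^ d := by
        rw [Real.inv_rpow (by positivity), ← Real.rpow_neg (by positivity), ← Real.rpow_natCast y 2,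
          ← Real.rpow_mul hy.le, ← Real.rpow_natCast y d]
        congr 1
        push_cast
        ring
      rw [h2, Real.mul_rpow (by positivity) (by positivity), h3]
      ring
  have h0 : (0 : ℝ) ^ d = 0 := zero_pow (by omega)
  rw [h0, zero_mul, zero_div, sub_zero] at key
  simp only [finrank_euclideanSpace, Fintype.card_fin, smul_eq_mul, nsmul_eq_mul]
  rw [key]
  field_simp

theorem integrable_norm_inv_mul (hd : 3 ≤ d) {u : Euc d → ℝ} (hu : Continuous u)
    (hc : HasCompactSupport u) : Integrable fun z : Euc d => 1 / ‖z‖ ^ (d - 2) * u z := by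
  have h : LocallyIntegrable fun z : Euc d => 1 / ‖z‖ ^ (d - 2) := by
    rw [locallyIntegrable_iff]
    intro K hK
    obtain ⟨r, hr⟩ := hK.isBounded.subset_ball 0
    exact (integrableOn_norm_inv hd r).mono_set hr
  refine (h.integrable_smul_left_of_hasCompactSupport hu hc).congr (.of_forall fun z => ?_)
  simp [mul_comm]

theorem tendsto_regularized_left (hd : 3 ≤ d) {u : Euc d → ℝ} (hu : Continuous u)
    (hc : HasCompactSupport u) :
    Tendsto (fun ε : ℝ => ∫ z : Euc d, (‖z‖ ^ 2 + ε ^ 2) ^ (-((d : ℝ) - 2) / 2) * u z) (𝓝[>] 0)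
      (𝓝 (∫ z, 1 / ‖z‖ ^ (d - 2) * u z)) := by
  have : Nonempty (Fin d) := ⟨⟨0, by omega⟩⟩
  have hd3 : (3 : ℝ) ≤ d := by exact_mod_cast hd
  -- At the origin the dominating kernel takes the default value `1 / 0 = 0` and bounds nothing;
  -- this null point is discarded.
  have hz0 : ∀ᵐ z : Euc d, z ≠ 0 := by simp [ae_iff]
  have hpow : ∀ z : Euc d, z ≠ 0 → (‖z‖ ^ 2) ^ (-((d : ℝ) - 2) / 2) = 1 / ‖z‖ ^ (d - 2) := by
    intro z hz
    rw [← Real.rpow_natCast ‖z‖ 2, ← Real.rpow_mul (norm_nonneg _), one_div,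
      ← Real.rpow_natCast ‖z‖ (d - 2), ← Real.rpow_neg (norm_nonneg _),
      Nat.cast_sub (by omega)]
    congr 1
    push_cast
    ring
  refine tendsto_integral_filter_of_dominated_convergence
    (fun z => ‖1 / ‖z‖ ^ (d - 2) * u z‖) ?_ ?_ (integrable_norm_inv_mul hd hu hc).norm ?_
  · filter_upwards [self_mem_nhdsWithin] with ε hε
    exact ((contDiff_regularized hε _).continuous.mul hu).aestronglyMeasurable
  · filter_upwards [self_mem_nhdsWithin] with ε (hε : 0 < ε)
    filter_upwards [hz0] with z hz
    have hz' : 0 < ‖z‖ := norm_pos_iff.2 hz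
    rw [norm_mul, norm_mul, ← hpow z hz]
    refine mul_le_mul_of_nonneg_right ?_ (norm_nonneg _)
    rw [Real.norm_of_nonneg (by positivity), Real.norm_of_nonneg (by positivity)]
    exact Real.rpow_le_rpow_of_nonpos (by positivity) (by nlinarith) (by linarith)
  · filter_upwards [hz0] with z hz
    have hz' : 0 < ‖z‖ := norm_pos_iff.2 hz
    rw [← hpow z hz]
    refine Tendsto.mul_const _ (Tendsto.rpow_const ?_ (.inl (by positivity)))
    have : Continuous fun ε : ℝ => ‖z‖ ^ 2 + ε ^ 2 := by fun_prop
    simpa using (this.tendsto 0).mono_left nhdsWithin_le_nhds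

/-- The kernel is `ε⁻ᵈ K(z / ε)` with `K(z) = (1 + ‖z‖²)^{-(d+2)/2}`, of total mass `sphereVol d /
d`. After the substitution `z ↦ ε z` dominated convergence applies, `u` being bounded. -/
theorem tendsto_regularized_right (hd : 3 ≤ d) {u : Euc d → ℝ} (hu : Continuous u)
    (hc : HasCompactSupport u) :
    Tendsto (fun ε : ℝ => ∫ z : Euc d, (ε ^ 2 * (‖z‖ ^ 2 + ε ^ 2) ^ (-((d : ℝ) + 2) / 2)) * u z)
      (𝓝[>] 0) (𝓝 (sphereVol d / d * u 0)) := by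
  have hd3 : (3 : ℝ) ≤ d := by exact_mod_cast hd
  rw [← integral_one_add_norm_sq hd, ← integral_mul_const]
  have h1 : Tendsto (fun ε : ℝ => ∫ z : Euc d, (1 + ‖z‖ ^ 2) ^ (-((d : ℝ) + 2) / 2) * u (ε • z))
      (𝓝[>] 0) (𝓝 (∫ z : Euc d, (1 + ‖z‖ ^ 2) ^ (-((d : ℝ) + 2) / 2) * u 0)) := by
    obtain ⟨M, hM⟩ := hu.bounded_above_of_compact_support hc
    have hK : Continuous fun z : Euc d => (1 + ‖z‖ ^ 2) ^ (-((d : ℝ) + 2) / 2) := by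
      refine Continuous.rpow_const (by fun_prop) fun z => .inl (by positivity)
    have hint : Integrable fun z : Euc d => (1 + ‖z‖ ^ 2) ^ (-((d : ℝ) + 2) / 2) :=
      integrable_rpow_neg_one_add_norm_sq (by simp)
    refine tendsto_integral_filter_of_dominated_convergence
      (fun z => (1 + ‖z‖ ^ 2) ^ (-((d : ℝ) + 2) / 2) * M) ?_ ?_ (hint.mul_const M) ?_
    · exact .of_forall fun ε => (hK.mul (hu.comp (continuous_const_smul ε))).aestronglyMeasurable
    · refine .of_forall fun ε => .of_forall fun z => ?_
      rw [norm_mul, Real.norm_of_nonneg (by positivity)]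
      exact mul_le_mul_of_nonneg_left (hM _) (by positivity)
    · refine .of_forall fun z => Tendsto.const_mul _ ?_
      have : Continuous fun ε : ℝ => u (ε • z) := by fun_prop
      simpa using (this.tendsto 0).mono_left nhdsWithin_le_nhds
  refine h1.congr' ?_
  filter_upwards [self_mem_nhdsWithin] with ε (hε : 0 < ε)
  have h2 := Measure.integral_comp_smul (volume : Measure (Euc d))
    (fun z : Euc d => (ε ^ 2 * (‖z‖ ^ 2 + ε ^ 2) ^ (-((d : ℝ) + 2) / 2)) * u z) ε
  rw [finrank_euclideanSpace, Fintype.card_fin, abs_of_pos (by positivity), smul_eq_mul,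
    eq_inv_mul_iff_mul_eq₀ (by positivity), ← integral_const_mul] at h2
  rw [← h2]
  congr 1
  ext z
  rw [norm_smul, Real.norm_of_nonneg hε.le,
    show (ε * ‖z‖) ^ 2 + ε ^ 2 = ε ^ 2 * (1 + ‖z‖ ^ 2) by ring,
    Real.mul_rpow (by positivity) (by positivity)]
  have h3 : ε ^ d * (ε ^ 2 * (ε ^ 2) ^ (-((d : ℝ) + 2) / 2)) = 1 := by
    rw [← mul_assoc, ← pow_add, ← Real.rpow_natCast ε 2, ← Real.rpow_mul hε.le,
      ← Real.rpow_natCast, ← Real.rpow_add hε]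
    convert Real.rpow_zero ε using 2
    push_cast
    ring
  linear_combination (-(1 + ‖z‖ ^ 2) ^ (-((d : ℝ) + 2) / 2) * u (ε • z)) * h3

/-- The Newtonian kernel is a fundamental solution of the Laplacian. -/
theorem integral_newtonian_laplacian (hd : 3 ≤ d) {u : Euc d → ℝ} (hu : ContDiff ℝ ∞ u)
    (hc : HasCompactSupport u) :
    ∫ z, 1 / ‖z‖ ^ (d - 2) * Laplacian.laplacian u z = -((d : ℝ) - 2) * sphereVol d * u 0 := by
  have hd3 : (3 : ℝ) ≤ d := by exact_mod_cast hd
  have hc' : HasCompactSupport (Laplacian.laplacian u) :=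
    hc.isCompact.of_isClosed_subset (isClosed_tsupport _) (tsupport_lap u)
  refine tendsto_nhds_unique (tendsto_regularized_left hd (contDiff_lap hu).continuous hc') ?_
  have h := (tendsto_regularized_right hd hu.continuous hc).const_mul (-((d : ℝ) - 2) * d)
  rw [show -((d : ℝ) - 2) * d * (sphereVol d / d * u 0) = -((d : ℝ) - 2) * sphereVol d * u 0 by
    field_simp] at h
  refine h.congr' ?_
  filter_upwards [self_mem_nhdsWithin] with ε (hε : 0 < ε)
  rw [integral_mul_laplacian (contDiff_regularized hε _) hu hc, ← integral_const_mul]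
  congr 1
  ext z
  rw [laplacian_newtonian hε]
  ring

theorem sphereVol_pos (hd : 3 ≤ d) : 0 < sphereVol d := by
  rw [sphereVol, Measure.toSphere_real_apply_univ, finrank_euclideanSpace, Fintype.card_fin]
  have : 0 < (volume : Measure (Euc d)).real (Metric.ball 0 1) :=
    ENNReal.toReal_pos (Metric.measure_ball_pos _ _ one_pos).ne' Metric.isBounded_ball.measure_lt_top.ne
  positivity

theorem integral_green_lap (hd : 3 ≤ d) (h : Test d) (x : Euc d) :
    ∫ y, green (x, y) * lap h y = h x := by
  have hd3 : (3 : ℝ) ≤ d := by exact_mod_cast hd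
  have hω := sphereVol_pos hd
  have hu : ContDiff ℝ ∞ fun z => h (x + z) := h.contDiff.comp (contDiff_const.add contDiff_id)
  have hc : HasCompactSupport fun z => h (x + z) :=
    h.hasCompactSupport.comp_homeomorph (Homeomorph.addLeft x)
  have hL : ∀ z, Laplacian.laplacian (fun z => h (x + z)) z = Laplacian.laplacian (h : Euc d → ℝ) (x + z) := by
    intro z
    simp_rw [InnerProductSpace.laplacian_eq_iteratedFDeriv_stdOrthonormalBasis,
      iteratedFDeriv_comp_add_left]
  have key := integral_newtonian_laplacian hd hu hc
  rw [← integral_add_left_eq_self _ x]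
  have h1 : ∀ z, green (x, x + z) * lap h (x + z) = -(((d : ℝ) - 2) * sphereVol d)⁻¹ *
      (1 / ‖z‖ ^ (d - 2) * Laplacian.laplacian (fun z => h (x + z)) z) := by
    intro z
    have h2 : lap h (x + z) = -Laplacian.laplacian (h : Euc d → ℝ) (x + z) := rfl
    have h3 : ‖x - (x + z)‖ = ‖z‖ := by rw [sub_add_cancel_left, norm_neg]
    rw [hL, h2, green, h3, one_div, mul_inv, one_div]
    ring
  simp_rw [h1]
  rw [integral_const_mul, key, add_zero]
  have : (d : ℝ) - 2 ≠ 0 := by linarith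
  field_simp

theorem greenPairing_apply (f g : Test d) :
    greenPairing f g = ∫ x, f x * ∫ y, green (x, y) * g y := by
  simp only [greenPairing, kernelPairing, LinearMap.mk₂_apply]
  rw [setIntegral_eq_integral_of_forall_compl_eq_zero, Measure.volume_eq_prod, integral_prod]
  · refine integral_congr_ae (.of_forall fun x => ?_)
    simp only
    rw [← integral_const_mul]
    congr 1
    ext y
    ring
  · exact integrable_kernel green locallyIntegrable_green f g
  · intro p hp
    rw [mem_prod, not_and_or] at hp
    rcases hp with hp | hp
    · rw [image_eq_zero_of_notMem_tsupport fun h => hp (f.tsupport_subset h)]; simp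
    · rw [image_eq_zero_of_notMem_tsupport fun h => hp (g.tsupport_subset h)]; simp

theorem l2_apply (f g : Test d) : l2 f g = ∫ x, f x * g x := by
  simp only [l2, LinearMap.mk₂_apply]
  refine setIntegral_eq_integral_of_forall_compl_eq_zero fun x hx => ?_
  rw [image_eq_zero_of_notMem_tsupport fun h => hx (f.tsupport_subset h), zero_mul]

theorem l2_symm (f g : Test d) : l2 f g = l2 g f := by
  simp_rw [l2_apply, mul_comm]

theorem greenPairing_lap (hd : 3 ≤ d) (f h : Test d) : greenPairing f (lap h) = l2 f h := by
  simp_rw [greenPairing_apply, integral_green_lap hd, l2_apply]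

/-- Both sides equal `G(Δf, Δg)`, so the symmetry of the Green pairing suffices. -/
theorem l2_lap (hd : 3 ≤ d) (f g : Test d) : l2 (lap f) g = l2 f (lap g) := by
  rw [← greenPairing_lap hd, greenPairing_symm, greenPairing_lap hd, l2_symm]

end Green

/-! ### Liouville's theorem as a distance formula. -/

section Liouville
open Set
open scoped ContDiff Gradient

variable {E : Type*} [NormedAddCommGroup E] [InnerProductSpace ℝ E]
variable {F : Type*} [NormedAddCommGroup F] [NormedSpace ℝ F]

section SecondDerivative
variable {U : Set E} {g : E → F}

theorem contDiffOn_fderiv_apply (hU : IsOpen U) (hg : ContDiffOn ℝ ∞ g U) (v : E) :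
    ContDiffOn ℝ ∞ (fun x => fderiv ℝ g x v) U :=
  (hg.fderiv_of_isOpen hU (m := ∞) (by norm_cast)).clm_apply contDiffOn_const

theorem ContDiffOn.differentiableAt_of_isOpen (hU : IsOpen U) (hg : ContDiffOn ℝ ∞ g U) {x : E}
    (hx : x ∈ U) : DifferentiableAt ℝ g x :=
  (hg.contDiffAt (hU.mem_nhds hx)).differentiableAt (by simp)

theorem fderiv_fderiv_apply (hU : IsOpen U) (hg : ContDiffOn ℝ ∞ g U) {x : E} (hx : x ∈ U)
    (u v : E) : fderiv ℝ (fun y => fderiv ℝ g y v) x u = fderiv ℝ (fderiv ℝ g) x u v := by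
  have h := ContDiffOn.differentiableAt_of_isOpen hU
    (hg.fderiv_of_isOpen hU (m := ∞) (by norm_cast)) hx
  rw [fderiv_clm_apply h (differentiableAt_const _)]
  simp

theorem fderiv_fderiv_comm (hU : IsOpen U) (hg : ContDiffOn ℝ ∞ g U) {x : E} (hx : x ∈ U)
    (u v : E) : fderiv ℝ (fderiv ℝ g) x u v = fderiv ℝ (fderiv ℝ g) x v u :=
  ((hg.contDiffAt (hU.mem_nhds hx)).isSymmSndFDerivAt
    (by rw [minSmoothness_of_isRCLikeNormedField]; norm_cast)).eq u v

theorem contDiffOn_fderiv_fderiv_apply (hU : IsOpen U) (hg : ContDiffOn ℝ ∞ g U) (u v : E) :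
    ContDiffOn ℝ ∞ (fun x => fderiv ℝ (fderiv ℝ g) x u v) U :=
  (contDiffOn_fderiv_apply hU (contDiffOn_fderiv_apply hU hg v) u).congr fun _ hx =>
    (fderiv_fderiv_apply hU hg hx u v).symm

theorem fderiv_congr_of_isOpen (hU : IsOpen U) {h : E → F} (hgh : ∀ x ∈ U, g x = h x) {x : E}
    (hx : x ∈ U) : fderiv ℝ g x = fderiv ℝ h x :=
  (Filter.eventuallyEq_of_mem (hU.mem_nhds hx) hgh).fderiv_eq

theorem fderiv_three_comm (hU : IsOpen U) (hg : ContDiffOn ℝ ∞ g U) {x : E} (hx : x ∈ U)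
    (u v w : E) : fderiv ℝ (fun y => fderiv ℝ (fderiv ℝ g) y u v) x w =
      fderiv ℝ (fun y => fderiv ℝ (fderiv ℝ g) y w v) x u := by
  have h := contDiffOn_fderiv_apply hU hg v
  rw [fderiv_congr_of_isOpen hU (fun y hy => (fderiv_fderiv_apply hU hg hy u v).symm) hx,
    fderiv_congr_of_isOpen hU (fun y hy => (fderiv_fderiv_apply hU hg hy w v).symm) hx,
    fderiv_fderiv_apply hU h hx, fderiv_fderiv_apply hU h hx, fderiv_fderiv_comm hU h hx]

/-- The only source of the dimension condition in this section: a direction orthogonal to two given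
vectors. -/
theorem exists_unit_orthogonal [FiniteDimensional ℝ E] (hE : 3 ≤ Module.finrank ℝ E) (u v : E) :
    ∃ w : E, ‖w‖ = 1 ∧ inner ℝ w u = 0 ∧ inner ℝ w v = 0 := by
  have h1 : (Submodule.span ℝ ({u, v} : Set E)) ≠ ⊤ := by
    intro h
    classical
    have h2 := finrank_span_finset_le_card (R := ℝ) ({u, v} : Finset E)
    rw [Set.finrank, Finset.coe_pair, h, finrank_top] at h2
    have h3 : ({u, v} : Finset E).card ≤ 2 := Finset.card_le_two
    omega
  have h2 : (Submodule.span ℝ ({u, v} : Set E))ᗮ ≠ ⊥ := fun h =>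
    h1 (Submodule.orthogonal_eq_bot_iff.1 h)
  obtain ⟨w, hw, hw0⟩ := Submodule.exists_mem_ne_zero_of_ne_bot h2
  refine ⟨‖w‖⁻¹ • w, ?_, ?_, ?_⟩
  · rw [norm_smul, norm_inv, norm_norm, inv_mul_cancel₀ (norm_ne_zero_iff.2 hw0)]
  · rw [inner_smul_left, (Submodule.mem_orthogonal' _ _).1 hw u (Submodule.subset_span (by simp)),
      mul_zero]
  · rw [inner_smul_left, (Submodule.mem_orthogonal' _ _).1 hw v (Submodule.subset_span (by simp)),
      mul_zero]

/-- If the second derivative is everywhere a multiple of the metric, the multiple is constant. -/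
theorem exists_const_of_umbilic [FiniteDimensional ℝ E] (hE : 3 ≤ Module.finrank ℝ E)
    (hU : IsOpen U) (hc : Convex ℝ U) (hg : ContDiffOn ℝ ∞ g U) (m : E → F)
    (hm : ∀ x ∈ U, ∀ u v, fderiv ℝ (fderiv ℝ g) x u v = inner ℝ u v • m x) :
    ∃ c, ∀ x ∈ U, m x = c := by
  obtain ⟨e, he, -, -⟩ := exists_unit_orthogonal hE (0 : E) 0
  have hm' : ∀ u : E, ‖u‖ = 1 → ∀ x ∈ U, m x = fderiv ℝ (fderiv ℝ g) x u u := fun u hu x hx => by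
    rw [hm x hx, real_inner_self_eq_norm_sq, hu, one_pow, one_smul]
  have hsm : ContDiffOn ℝ ∞ m U := (contDiffOn_fderiv_fderiv_apply hU hg e e).congr (hm' e he)
  have hd : ∀ x ∈ U, fderiv ℝ m x = 0 := by
    intro x hx
    ext w
    -- With a unit `u` orthogonal to `w`, the third derivative `D_w D²g(u, u)` equals `D_u D²g(w,
    -- u)`, the derivative of a function that is zero on `U`.
    obtain ⟨u, hu, huw, -⟩ := exists_unit_orthogonal hE w w
    rw [fderiv_congr_of_isOpen hU (hm' u hu) hx, fderiv_three_comm hU hg hx,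
      fderiv_congr_of_isOpen (h := fun _ => (0 : F)) hU (fun y hy => by
        rw [hm y hy, real_inner_comm, huw, zero_smul]) hx]
    simp
  rcases U.eq_empty_or_nonempty with rfl | ⟨x₀, hx₀⟩
  · exact ⟨0, by simp⟩
  · exact ⟨m x₀, fun x hx => hU.is_const_of_fderiv_eq_zero hc.isPreconnected
      (fun y hy => (ContDiffOn.differentiableAt_of_isOpen hU hsm hy).differentiableWithinAt)
      hd hx hx₀⟩

/-- Integrating the constant Hessian twice: first the derivative minus its affine candidate is
constant, then the function minus its quadratic candidate. -/
theorem eq_taylor_of_umbilic (hU : IsOpen U) (hc : Convex ℝ U) (hg : ContDiffOn ℝ ∞ g U) (c : F)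
    (hm : ∀ x ∈ U, ∀ u v, fderiv ℝ (fderiv ℝ g) x u v = inner ℝ u v • c) {x y : E}
    (hx : x ∈ U) (hy : y ∈ U) :
    g y = g x + fderiv ℝ g x (y - x) + (‖y - x‖ ^ 2 / 2) • c := by
  have h1 : ∀ z ∈ U, ∀ u, fderiv ℝ g z u = fderiv ℝ g x u + inner ℝ (z - x) u • c := by
    intro z hz u
    have hd : ∀ y ∈ U, HasFDerivAt (fun z => fderiv ℝ g z u - inner ℝ (z - x) u • c)
        (fderiv ℝ (fun z => fderiv ℝ g z u) y - (innerSL ℝ u).smulRight c) y := by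
      intro y hy
      refine (ContDiffOn.differentiableAt_of_isOpen hU
        (contDiffOn_fderiv_apply hU hg u) hy).hasFDerivAt.sub ?_
      have : HasFDerivAt (fun z => inner ℝ (z - x) u) (innerSL ℝ u) y := by
        simp_rw [real_inner_comm u]
        exact (innerSL ℝ u).hasFDerivAt.comp y ((hasFDerivAt_id y).sub_const x)
      exact this.smul_const c
    have := hU.is_const_of_fderiv_eq_zero hc.isPreconnected
      (fun y hy => (hd y hy).differentiableAt.differentiableWithinAt) (fun y hy => by
        rw [(hd y hy).fderiv]
        ext w
        simp [fderiv_fderiv_apply hU hg hy, hm y hy, real_inner_comm u w]) hz hx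
    simp only [sub_self, inner_zero_left, zero_smul, sub_zero] at this
    rw [← this]
    abel
  have hd : ∀ y ∈ U, HasFDerivAt
      (fun z => g z - fderiv ℝ g x (z - x) - (‖z - x‖ ^ 2 / 2) • c)
      (fderiv ℝ g y - fderiv ℝ g x - (innerSL ℝ (y - x)).smulRight c) y := by
    intro y hy
    refine ((ContDiffOn.differentiableAt_of_isOpen hU hg hy).hasFDerivAt.sub
      ((fderiv ℝ g x).hasFDerivAt.comp y ((hasFDerivAt_id y).sub_const x))).sub ?_
    have h2 := ((hasStrictFDerivAt_norm_sq (y - x)).hasFDerivAt.comp y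
      ((hasFDerivAt_id y).sub_const x)).const_mul (2⁻¹ : ℝ)
    have h3 : HasFDerivAt (fun z => ‖z - x‖ ^ 2 / 2) (innerSL ℝ (y - x)) y := by
      refine (h2.congr_of_eventuallyEq (.of_forall fun z => ?_)).congr_fderiv ?_
      · simp [div_eq_inv_mul]
      · ext w; simp
    exact h3.smul_const c
  have := hU.is_const_of_fderiv_eq_zero hc.isPreconnected
    (fun y hy => (hd y hy).differentiableAt.differentiableWithinAt) (fun y hy => by
      rw [(hd y hy).fderiv]
      ext w
      simp only [sub_apply, ContinuousLinearMap.smulRight_apply,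
        innerSL_apply_apply, h1 y hy w, zero_apply, Pi.zero_apply]
      abel) hy hx
  simp only [sub_self, map_zero, sub_zero, norm_zero] at this
  rw [sub_eq_iff_eq_add, sub_eq_iff_eq_add] at this
  rw [this]
  simp
  abel

end SecondDerivative

/-- `f` is a smooth map on the open set `U` whose derivative is conformal with factor `ρ⁻¹`. -/
structure IsConformalOn (f : E → E) (ρ : E → ℝ) (U : Set E) : Prop where
  isOpen : IsOpen U
  contDiffOn : ContDiffOn ℝ ∞ f U
  contDiffOn_factor : ContDiffOn ℝ ∞ ρ U
  pos : ∀ x ∈ U, 0 < ρ x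
  inner_eq : ∀ x ∈ U, ∀ u v, ρ x ^ 2 * inner ℝ (fderiv ℝ f x u) (fderiv ℝ f x v) = inner ℝ u v

namespace IsConformalOn
variable {U : Set E} {f : E → E} {ρ : E → ℝ} (h : IsConformalOn f ρ U)
include h

theorem surjective [FiniteDimensional ℝ E] {x : E} (hx : x ∈ U) :
    Function.Surjective (fderiv ℝ f x) := by
  have hinj : Function.Injective (fderiv ℝ f x).toLinearMap := by
    refine (injective_iff_map_eq_zero _).2 fun u hu => ?_
    have h1 := h.inner_eq x hx u u
    rw [show fderiv ℝ f x u = 0 from hu, inner_zero_left, mul_zero] at h1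
    exact inner_self_eq_zero.1 h1.symm
  exact LinearMap.surjective_of_injective hinj

/-- The Koszul formula for a conformal map. -/
theorem inner_fderiv_fderiv {x : E} (hx : x ∈ U) (u v w : E) :
    ρ x ^ 3 * inner ℝ (fderiv ℝ (fderiv ℝ f) x u v) (fderiv ℝ f x w) =
      -(fderiv ℝ ρ x u * inner ℝ v w) - fderiv ℝ ρ x v * inner ℝ u w
        + fderiv ℝ ρ x w * inner ℝ u v := by
  have hU := h.isOpen
  -- The conformality identity for `v, w`, differentiated along `u` and multiplied by `ρ`. Three
  -- permutations of it and the symmetry of `D²f` isolate a single term.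
  have key : ∀ u v w : E, 2 * fderiv ℝ ρ x u * inner ℝ v w + ρ x ^ 3 *
      (inner ℝ (fderiv ℝ (fderiv ℝ f) x u v) (fderiv ℝ f x w) +
        inner ℝ (fderiv ℝ (fderiv ℝ f) x u w) (fderiv ℝ f x v)) = 0 := by
    intro u v w
    have hd := fun v => ContDiffOn.differentiableAt_of_isOpen hU
      (contDiffOn_fderiv_apply hU h.contDiffOn v) hx
    have hdρ := ContDiffOn.differentiableAt_of_isOpen hU h.contDiffOn_factor hx
    have h1 := congrArg (fun L => L u)
      (fderiv_congr_of_isOpen hU (fun y hy => h.inner_eq y hy v w) hx)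
    rw [fderiv_fun_mul (hdρ.fun_pow 2) ((hd v).inner ℝ (hd w)), fderiv_fun_const] at h1
    simp only [add_apply, smul_apply, smul_eq_mul, fderiv_inner_apply ℝ (hd v) (hd w),
      fderiv_fun_pow 2 hdρ, fderiv_fderiv_apply hU h.contDiffOn hx, Pi.zero_apply,
      zero_apply] at h1
    rw [← h.inner_eq x hx v w]
    rw [real_inner_comm _ (fderiv ℝ f x v)] at h1
    simp at h1
    linear_combination ρ x * h1
  have hs : ∀ u v w, inner ℝ (fderiv ℝ (fderiv ℝ f) x u v) (fderiv ℝ f x w) =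
      inner ℝ (fderiv ℝ (fderiv ℝ f) x v u) (fderiv ℝ f x w) := fun u v w => by
    rw [fderiv_fderiv_comm hU h.contDiffOn hx]
  have h1 := key u v w
  have h2 := key v w u
  have h3 := key w u v
  rw [hs w u, hs w v] at h3
  rw [hs v u, real_inner_comm u w] at h2
  linear_combination (h1 + h2 - h3) / 2

theorem contDiffOn_smul : ContDiffOn ℝ ∞ (fun y => ρ y • f y) U :=
  h.contDiffOn_factor.smul h.contDiffOn

theorem fderiv_smul {x : E} (hx : x ∈ U) (v : E) : fderiv ℝ (fun y => ρ y • f y) x v =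
    fderiv ℝ ρ x v • f x + ρ x • fderiv ℝ f x v := by
  rw [fderiv_fun_smul (ContDiffOn.differentiableAt_of_isOpen h.isOpen h.contDiffOn_factor hx)
    (ContDiffOn.differentiableAt_of_isOpen h.isOpen h.contDiffOn hx)]
  simp [add_comm]

variable [FiniteDimensional ℝ E] [CompleteSpace E]

/-- The vectors `Df w` exhaust the space, so the Koszul formula determines `D²f` completely. -/
theorem smul_fderiv_fderiv {x : E} (hx : x ∈ U) (u v : E) :
    ρ x • fderiv ℝ (fderiv ℝ f) x u v = -(fderiv ℝ ρ x u • fderiv ℝ f x v) -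
      fderiv ℝ ρ x v • fderiv ℝ f x u + inner ℝ u v • fderiv ℝ f x (∇ ρ x) := by
  refine ext_inner_right ℝ fun w' => ?_
  obtain ⟨w, rfl⟩ := h.surjective hx w'
  have h1 := h.inner_fderiv_fderiv hx u v w
  have h0 := (h.pos x hx).ne'
  simp only [inner_add_left, inner_sub_left, inner_neg_left, real_inner_smul_left]
  rw [← mul_right_inj' (pow_ne_zero 2 h0)]
  have h2 := h.inner_eq x hx (∇ ρ x) w
  rw [inner_gradient_left] at h2
  linear_combination h1 + fderiv ℝ ρ x u * h.inner_eq x hx v w +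
    fderiv ℝ ρ x v * h.inner_eq x hx u w - inner ℝ u v * h2

/-- Multiplication by `ρ` is chosen so that the mixed terms `Dρ(u) Df(v) + Dρ(v) Df(u)` cancel those
in `ρ D²f`. -/
theorem fderiv_fderiv_smul {x : E} (hx : x ∈ U) (u v : E) :
    fderiv ℝ (fderiv ℝ fun y => ρ y • f y) x u v =
      fderiv ℝ (fderiv ℝ ρ) x u v • f x + inner ℝ u v • fderiv ℝ f x (∇ ρ x) := by
  have hU := h.isOpen
  have d1 := ContDiffOn.differentiableAt_of_isOpen hU h.contDiffOn_factor hx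
  have d2 := ContDiffOn.differentiableAt_of_isOpen hU h.contDiffOn hx
  have d3 := ContDiffOn.differentiableAt_of_isOpen hU
    (contDiffOn_fderiv_apply hU h.contDiffOn_factor v) hx
  have d4 := ContDiffOn.differentiableAt_of_isOpen hU
    (contDiffOn_fderiv_apply hU h.contDiffOn v) hx
  rw [← fderiv_fderiv_apply hU h.contDiffOn_smul hx,
    fderiv_congr_of_isOpen hU (fun y hy => h.fderiv_smul hy v) hx,
    fderiv_fun_add (d3.fun_smul d2) (d1.fun_smul d4), fderiv_fun_smul d3 d2, fderiv_fun_smul d1 d4]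
  simp only [add_apply, smul_apply, ContinuousLinearMap.smulRight_apply,
    fderiv_fderiv_apply hU h.contDiffOn hx, fderiv_fderiv_apply hU h.contDiffOn_factor hx,
    h.smul_fderiv_fderiv hx]
  abel

variable (hE : 3 ≤ Module.finrank ℝ E)
include hE

/-- For orthogonal `u, v` the second derivative of `ρ f` is `D²ρ(u, v) f`. Differentiate along a
unit `w` orthogonal to both and exchange `u` with `w`: the third derivatives of `ρ` cancel, leaving
`D²ρ(u, v) Df(w) = D²ρ(w, v) Df(u)`. As `Df(u)` and `Df(w)` are orthogonal and `Df(w) ≠ 0`, the left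
coefficient vanishes. -/
theorem fderiv_fderiv_factor_eq_zero {x : E} (hx : x ∈ U) {u v : E} (huv : inner ℝ u v = 0) :
    fderiv ℝ (fderiv ℝ ρ) x u v = 0 := by
  have hU := h.isOpen
  have hs := h.contDiffOn_smul
  obtain ⟨w, hw, hwu, hwv⟩ := exists_unit_orthogonal hE u v
  have key : ∀ u w, inner ℝ u v = 0 → fderiv ℝ (fun y =>
      fderiv ℝ (fderiv ℝ fun y => ρ y • f y) y u v) x w =
      fderiv ℝ (fun y => fderiv ℝ (fderiv ℝ ρ) y u v) x w • f x +
        fderiv ℝ (fderiv ℝ ρ) x u v • fderiv ℝ f x w := by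
    intro u w huv
    rw [fderiv_congr_of_isOpen hU (fun y hy => h.fderiv_fderiv_smul hy u v) hx]
    simp only [huv, zero_smul, add_zero]
    rw [fderiv_fun_smul (ContDiffOn.differentiableAt_of_isOpen hU
      (contDiffOn_fderiv_fderiv_apply hU h.contDiffOn_factor u v) hx)
      (ContDiffOn.differentiableAt_of_isOpen hU h.contDiffOn hx)]
    simp [add_comm]
  have h1 := fderiv_three_comm hU hs hx u v w
  rw [key u w huv, key w u hwv, fderiv_three_comm hU h.contDiffOn_factor hx u v w,
    add_right_inj] at h1
  have h2 := congrArg (fun z => ρ x ^ 2 * inner ℝ z (fderiv ℝ f x w)) h1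
  simp only [real_inner_smul_left] at h2
  have h3 : inner ℝ w w = (1 : ℝ) := by rw [real_inner_self_eq_norm_sq, hw, one_pow]
  rw [real_inner_comm] at hwu
  linear_combination h2 - fderiv ℝ (fderiv ℝ ρ) x u v * (h3 + h.inner_eq x hx w w) +
    fderiv ℝ (fderiv ℝ ρ) x w v * (hwu + h.inner_eq x hx u w)

theorem exists_factor_hessian (hc : Convex ℝ U) : ∃ c : ℝ, ∀ x ∈ U, ∀ u v,
    fderiv ℝ (fderiv ℝ ρ) x u v = inner ℝ u v • c := by
  obtain ⟨e, he, -, -⟩ := exists_unit_orthogonal hE (0 : E) 0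
  have hU := h.isOpen
  have h1 : ∀ x ∈ U, ∀ u v, fderiv ℝ (fderiv ℝ ρ) x u v =
      inner ℝ u v • fderiv ℝ (fderiv ℝ ρ) x e e := by
    intro x hx
    have hcomm := fderiv_fderiv_comm hU h.contDiffOn_factor hx
    set H := fderiv ℝ (fderiv ℝ ρ) x with hH
    have h2 : ∀ u v : E, ‖u‖ = ‖v‖ → H u u = H v v := by
      intro u v huv
      -- For vectors of equal length, `u + v` and `u - v` are orthogonal, and `H(u + v, u - v) =
      -- H(u, u) - H(v, v)`. Polarization then makes `H` a multiple of the metric.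
      have := h.fderiv_fderiv_factor_eq_zero hE hx (u := u + v) (v := u - v) (by
        rw [inner_add_left, inner_sub_right, inner_sub_right, real_inner_self_eq_norm_sq,
          real_inner_self_eq_norm_sq, huv, real_inner_comm u v]; ring)
      rw [← hH] at this
      simp only [map_add, map_sub, add_apply, hcomm v u] at this
      linear_combination this
    have h3 : ∀ u : E, H u u = ‖u‖ ^ 2 * H e e := by
      intro u
      rw [h2 u (‖u‖ • e) (by rw [norm_smul, he, norm_norm, mul_one])]
      simp
      ring
    intro u v
    have h4 := h3 (u + v)
    simp only [map_add, add_apply, hcomm v u, h3 u, h3 v, norm_add_sq_real] at h4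
    rw [smul_eq_mul]
    linear_combination h4 / 2
  obtain ⟨c, hc⟩ := exists_const_of_umbilic hE hU hc h.contDiffOn_factor _ h1
  exact ⟨c, fun x hx u v => by rw [h1 x hx, hc x hx]⟩

/-- **Liouville's theorem** in integrated form: a conformal map on a convex open set in dimension
at least three scales distances by the geometric mean of the conformal factors. -/
theorem norm_sub_sq (hc : Convex ℝ U) {x y : E} (hx : x ∈ U) (hy : y ∈ U) :
    ‖f y - f x‖ ^ 2 * (ρ x * ρ y) = ‖y - x‖ ^ 2 := by
  have hU := h.isOpen
  have hs := h.contDiffOn_smul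
  obtain ⟨c, hρ⟩ := h.exists_factor_hessian hE hc
  have hQ : ∀ x ∈ U, ∀ u v, fderiv ℝ (fderiv ℝ fun y => ρ y • f y) x u v =
      inner ℝ u v • (c • f x + fderiv ℝ f x (∇ ρ x)) := by
    intro x hx u v
    rw [h.fderiv_fderiv_smul hx, hρ x hx, smul_assoc, smul_add]
  obtain ⟨Λ, hΛ⟩ := exists_const_of_umbilic hE hU hc hs _ hQ
  have hin : ∀ x ∈ U, ∀ v, fderiv ℝ (∇ ρ) x v = c • v ∧ DifferentiableAt ℝ (∇ ρ) x := by
    intro x hx v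
    have h1 : HasFDerivAt (fderiv ℝ ρ) (fderiv ℝ (fderiv ℝ ρ) x) x :=
      (ContDiffOn.differentiableAt_of_isOpen hU
        (h.contDiffOn_factor.fderiv_of_isOpen hU (m := ∞) (by norm_cast)) hx).hasFDerivAt
    have h2 : HasFDerivAt (∇ ρ) _ x :=
      (InnerProductSpace.toDual ℝ E).symm.toContinuousLinearEquiv.hasFDerivAt.comp x h1
    refine ⟨ext_inner_right ℝ fun w => ?_, h2.differentiableAt⟩
    rw [h2.fderiv, real_inner_smul_left]
    change inner ℝ ((InnerProductSpace.toDual ℝ E).symm (fderiv ℝ (fderiv ℝ ρ) x v)) w = _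
    rw [InnerProductSpace.toDual_symm_apply, hρ x hx, smul_eq_mul, mul_comm]
  have hnorm : ∀ x ∈ U, ‖∇ ρ x‖ ^ 2 = 2 * c * ρ x := by
    intro x hx
    obtain ⟨v, hv, -, -⟩ := exists_unit_orthogonal hE (0 : E) 0
    have d1 := ContDiffOn.differentiableAt_of_isOpen hU h.contDiffOn hx
    have d2 := ContDiffOn.differentiableAt_of_isOpen hU
      (h.contDiffOn.fderiv_of_isOpen hU (m := ∞) (by norm_cast)) hx
    -- Differentiating the constant vector `Λ = c f + Df(∇ρ)` along `v` and inserting the formula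
    -- for `ρ D²f` gives `(2cρ - ‖∇ρ‖²) Df(v) = 0`.
    have h1 := congrArg (fun L => ρ x • L v) (fderiv_congr_of_isOpen hU hΛ hx)
    rw [fderiv_fun_add (d1.fun_const_smul c) (d2.clm_apply (hin x hx v).2),
      fderiv_fun_const_smul d1, fderiv_clm_apply d2 (hin x hx v).2] at h1
    simp only [add_apply, smul_apply, ContinuousLinearMap.flip_apply, (hin x hx v).1,
      fderiv_fun_const, Pi.zero_apply, zero_apply, smul_zero, smul_add, map_smul,
      ContinuousLinearMap.comp_apply, h.smul_fderiv_fderiv hx, inner_gradient_right,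
      conj_trivial] at h1
    have h2 : inner ℝ (∇ ρ x) (∇ ρ x) = fderiv ℝ ρ x (∇ ρ x) := inner_gradient_left
    rw [real_inner_self_eq_norm_sq] at h2
    rw [← h2] at h1
    have h3 : (2 * c * ρ x - ‖∇ ρ x‖ ^ 2) • fderiv ℝ f x v = 0 := by
      rw [← h1]
      module
    rcases smul_eq_zero.1 h3 with h4 | h4
    · linarith
    · have h5 := h.inner_eq x hx v v
      rw [h4, inner_zero_left, mul_zero, real_inner_self_eq_norm_sq, hv] at h5
      norm_num at h5
  have hx0 := h.pos x hx
  have hy0 := h.pos y hy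
  have t1 := eq_taylor_of_umbilic hU hc h.contDiffOn_factor c hρ hx hy
  have t2 := eq_taylor_of_umbilic hU hc hs Λ (fun z hz u v => by rw [hQ z hz, hΛ z hz]) hx hy
  rw [h.fderiv_smul hx, ← hΛ x hx] at t2
  -- The exact expansion of `ρ f` minus `f x` times that of `ρ`: what is left lies in the image of
  -- `Df` at `x`, whose effect on norms is known.
  have h1 : ρ y • (f y - f x) =
      fderiv ℝ f x (ρ x • (y - x) + (‖y - x‖ ^ 2 / 2) • ∇ ρ x) := by
    rw [smul_sub, t2, t1, map_add, map_smul, map_smul, smul_eq_mul]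
    module
  have h2 := h.inner_eq x hx (ρ x • (y - x) + (‖y - x‖ ^ 2 / 2) • ∇ ρ x)
    (ρ x • (y - x) + (‖y - x‖ ^ 2 / 2) • ∇ ρ x)
  rw [← h1, real_inner_self_eq_norm_sq, real_inner_self_eq_norm_sq, norm_add_sq_real, norm_smul,
    norm_smul, norm_smul, real_inner_smul_left, real_inner_smul_right, inner_gradient_right,
    conj_trivial, Real.norm_of_nonneg hx0.le, Real.norm_of_nonneg hy0.le,
    Real.norm_of_nonneg (by positivity), mul_pow, mul_pow, mul_pow, hnorm x hx] at h2
  rw [smul_eq_mul] at t1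
  have h3 : fderiv ℝ ρ x (y - x) = ρ y - ρ x - ‖y - x‖ ^ 2 / 2 * c := by linarith
  rw [h3] at h2
  -- With `‖∇ρ x‖² = 2cρ x`, the squared norm of the argument is `ρ x ‖y - x‖²` times the Taylor
  -- expansion of `ρ y`.
  have h4 : ρ x * ρ y * (‖f y - f x‖ ^ 2 * (ρ x * ρ y)) = ρ x * ρ y * ‖y - x‖ ^ 2 := by
    linear_combination h2
  exact mul_left_cancel₀ (mul_pos hx0 hy0).ne' h4

end IsConformalOn
end Liouville

/-! ### Conformal covariance of Green's function and the Laplacian. -/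

section Covariance
open Set MeasureTheory TopologicalSpace
open scoped ContDiff
variable {d : ℕ}

/-- A function which is smooth on the disk and vanishes outside a compact subset of the disk, as a
test function. -/
def Test.ofContDiffOn (F : Euc d → ℝ) (hF : ContDiffOn ℝ ∞ F (disk d)) (K : Set (Euc d))
    (hK : IsCompact K) (hKd : K ⊆ disk d) (h0 : ∀ x ∉ K, F x = 0) : Test d :=
  have ht : tsupport F ⊆ K := closure_minimal (fun x hx => by
    by_contra h
    exact hx (h0 x h)) hK.isClosed
  { toFun := F
    contDiff' := by
      rw [contDiff_iff_contDiffAt]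
      intro x
      by_cases hx : x ∈ disk d
      · exact hF.contDiffAt ((disk d).2.mem_nhds hx)
      · refine contDiffAt_const (c := (0 : ℝ)) |>.congr_of_eventuallyEq ?_
        filter_upwards [hK.isClosed.isOpen_compl.mem_nhds fun h => hx (hKd h)] with y hy
        exact h0 y hy
    hasCompactSupport' := hK.of_isClosed_subset (isClosed_tsupport _) ht
    tsupport_subset' := ht.trans hKd }

theorem Test.coe_ofContDiffOn (F : Euc d → ℝ) (hF : ContDiffOn ℝ ∞ F (disk d)) (K : Set (Euc d))
    (hK : IsCompact K) (hKd : K ⊆ disk d) (h0 : ∀ x ∉ K, F x = 0) :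
    (Test.ofContDiffOn F hF K hK hKd h0 : Euc d → ℝ) = F := rfl

theorem Test.eq_zero_of_l2_self (f : Test d) (hf : l2 f f = 0) : f = 0 := by
  rw [l2_apply] at hf
  have h1 : (fun x => f x * f x) = 0 :=
    ((f.continuous.mul f.continuous).ae_eq_iff_eq volume continuous_const).1
      ((integral_eq_zero_iff_of_nonneg (fun x => mul_self_nonneg _) (integrable_mul f f)).1 hf)
  ext x
  exact mul_self_eq_zero.1 (congrFun h1 x)

namespace ConfEmb
variable (φ : ConfEmb d)

theorem coe_W (f : Test d) : (φ.W f : Euc d → ℝ) = φ.weight f := rfl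

theorem factor_pos {x : Euc d} (hx : x ∈ disk d) : 0 < φ.factor x := (φ.factor_spec.2 x hx).1

theorem W_extend (f : Test d) {x : Euc d} (hx : x ∈ disk d) :
    φ.W f (extend φ.toFun x) = φ.factor x ^ (-((d : ℝ) + 2) / 2) * f x := by
  have := φ.weight_coe f ⟨x, hx⟩
  rwa [← extend_coe] at this

theorem mem_range_of_W_ne_zero {f : Test d} {y : Euc d} (h : φ.W f y ≠ 0) :
    ∃ x : disk d, (φ.toFun x : Euc d) = y := by
  by_contra hy
  push Not at hy
  exact h (φ.weight_of_forall_ne f y hy)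

/-- The factor is a choice; one unit vector, available for `d > 0`, pins down its value on the disk.
Functoriality of `W` depends on this. -/
theorem factor_eq_of_forall (hd : 0 < d) {x : Euc d} (hx : x ∈ disk d) {c : ℝ} (hc : 0 < c)
    (h : ∀ u v : Euc d, inner ℝ (fderiv ℝ (extend φ.toFun) x u)
      (fderiv ℝ (extend φ.toFun) x v) = c ^ 2 * inner ℝ u v) : φ.factor x = c := by
  have h1 := (φ.factor_spec.2 x hx).2 (stdVec ⟨0, hd⟩) (stdVec ⟨0, hd⟩)
  rw [h] at h1
  simp only [EuclideanSpace.inner_single_right, PiLp.single_apply] at h1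
  simp only [if_true, conj_trivial, mul_one] at h1
  exact ((sq_eq_sq₀ hc.le (φ.factor_pos hx).le).1 h1).symm

theorem factor_one (hd : 0 < d) {x : Euc d} (hx : x ∈ disk d) : (1 : ConfEmb d).factor x = 1 := by
  refine factor_eq_of_forall _ hd hx one_pos fun u v => ?_
  change inner ℝ (fderiv ℝ (extend (id : disk d → disk d)) x u) _ = _
  rw [show (1 : ConfEmb d).toFun = id from rfl, (extend_id_eventuallyEq hx).fderiv_eq]
  simp

theorem factor_mul (hd : 0 < d) (ψ : ConfEmb d) {x : Euc d} (hx : x ∈ disk d) :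
    (φ * ψ).factor x = φ.factor (extend ψ.toFun x) * ψ.factor x := by
  have hy := extend_mem ψ.toFun hx
  refine factor_eq_of_forall _ hd hx (mul_pos (φ.factor_pos hy) (ψ.factor_pos hx)) fun u v => ?_
  rw [show (φ * ψ).toFun = φ.toFun ∘ ψ.toFun from rfl, fderiv_extend_comp φ ψ hx,
    ContinuousLinearMap.comp_apply, ContinuousLinearMap.comp_apply, (φ.factor_spec.2 _ hy).2,
    (ψ.factor_spec.2 x hx).2]
  ring

theorem W_one (hd : 0 < d) : (1 : ConfEmb d).W = LinearMap.id := by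
  ext f x
  by_cases hx : x ∈ disk d
  · have h := (1 : ConfEmb d).W_extend f hx
    rw [factor_one hd hx, Real.one_rpow, one_mul] at h
    rwa [show extend (1 : ConfEmb d).toFun x = x from extend_coe id ⟨x, hx⟩] at h
  · rw [LinearMap.id_apply, image_eq_zero_of_notMem_tsupport fun h => hx (f.tsupport_subset h),
      image_eq_zero_of_notMem_tsupport fun h => hx (((1 : ConfEmb d).W f).tsupport_subset h)]

theorem W_mul (hd : 0 < d) (ψ : ConfEmb d) : (φ * ψ).W = φ.W ∘ₗ ψ.W := by
  ext f y
  rw [LinearMap.comp_apply]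
  by_cases h : ∃ x : disk d, ((φ * ψ).toFun x : Euc d) = y
  · obtain ⟨⟨x, hx⟩, rfl⟩ := h
    have h1 := (φ * ψ).W_extend f hx
    have hy := extend_mem ψ.toFun hx
    have h2 := φ.W_extend (ψ.W f) hy
    rw [ψ.W_extend f hx, ← mul_assoc, ← Real.mul_rpow (φ.factor_pos hy).le (ψ.factor_pos hx).le,
      ← factor_mul φ hd ψ hx, ← h1, ← extend_comp _ _ hx] at h2
    rw [← extend_coe]
    exact h2.symm
  -- Off the image of the composite, a nonzero value of `W_φ (W_ψ f)` would still exhibit a preimage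
  -- under both maps.
  · rw [show (φ * ψ).W f y = 0 from dif_neg h]
    by_contra h0
    obtain ⟨z, rfl⟩ := φ.mem_range_of_W_ne_zero (Ne.symm h0)
    have h1 := φ.W_extend (ψ.W f) z.2
    rw [extend_coe] at h1
    have h2 : ψ.W f z ≠ 0 := fun h2 => h0 (by rw [h1, h2, mul_zero])
    obtain ⟨x, hx⟩ := ψ.mem_range_of_W_ne_zero h2
    refine h ⟨x, ?_⟩
    rw [← Subtype.ext hx]
    rfl

theorem isConformalOn : IsConformalOn (extend φ.toFun) (fun x => (φ.factor x)⁻¹) (disk d) where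
  isOpen := (disk d).2
  contDiffOn := φ.smooth
  contDiffOn_factor := φ.factor_spec.1.inv fun x hx => (φ.factor_pos hx).ne'
  pos x hx := inv_pos.2 (φ.factor_pos hx)
  inner_eq x hx u v := by
    have := (φ.factor_pos hx).ne'
    rw [(φ.factor_spec.2 x hx).2]
    field_simp

theorem norm_extend_sub_sq (hd : 3 ≤ d) {x y : Euc d} (hx : x ∈ disk d) (hy : y ∈ disk d) :
    ‖extend φ.toFun x - extend φ.toFun y‖ ^ 2 = φ.factor x * φ.factor y * ‖x - y‖ ^ 2 := by
  have h := φ.isConformalOn.norm_sub_sq (by simpa using hd) (convex_ball (0 : Euc d) 1) hy hx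
  have h1 := (φ.factor_pos hx).ne'
  have h2 := (φ.factor_pos hy).ne'
  rw [← h]
  field_simp

/-- The distance formula raised to the power `-(d - 2) / 2`, so that each point carries its own
weight. -/
theorem green_extend (hd : 3 ≤ d) {x y : Euc d} (hx : x ∈ disk d) (hy : y ∈ disk d) :
    φ.factor x ^ (((d : ℝ) - 2) / 2) * φ.factor y ^ (((d : ℝ) - 2) / 2) *
      green (extend φ.toFun x, extend φ.toFun y) = green (x, y) := by
  have hx0 := φ.factor_pos hx
  have hy0 := φ.factor_pos hy
  rw [← Real.mul_rpow hx0.le hy0.le]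
  set s := φ.factor x * φ.factor y with hs
  have hs0 : 0 < s := mul_pos hx0 hy0
  have h1 : ‖extend φ.toFun x - extend φ.toFun y‖ = Real.sqrt s * ‖x - y‖ := by
    rw [← Real.sqrt_sq (norm_nonneg (extend φ.toFun x - _)), φ.norm_extend_sub_sq hd hx hy,
      Real.sqrt_mul hs0.le, Real.sqrt_sq (norm_nonneg _)]
  have h2 : Real.sqrt s ^ (d - 2) = s ^ (((d : ℝ) - 2) / 2) := by
    rw [Real.sqrt_eq_rpow, ← Real.rpow_natCast, ← Real.rpow_mul hs0.le, Nat.cast_sub (by omega)]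
    congr 1
    push_cast
    ring
  have h3 : s ^ (((d : ℝ) - 2) / 2) ≠ 0 := (Real.rpow_pos_of_pos hs0 _).ne'
  simp only [green]
  rw [h1, mul_pow, h2, mul_left_comm _ (s ^ _), one_div, mul_inv, ← mul_assoc, mul_inv_cancel₀ h3,
    one_mul, one_div]

theorem abs_det_fderiv {x : Euc d} (hx : x ∈ disk d) :
    |(fderiv ℝ (extend φ.toFun) x).det| = φ.factor x ^ d := by
  have h := LinearMap.normDet_sq_eq_det_gram (fderiv ℝ (extend φ.toFun) x).toLinearMap
    (EuclideanSpace.basisFun (Fin d) ℝ)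
  have h2 : Matrix.gram ℝ (fun i => (fderiv ℝ (extend φ.toFun) x).toLinearMap
      (EuclideanSpace.basisFun (Fin d) ℝ i)) = (φ.factor x ^ 2) • (1 : Matrix (Fin d) (Fin d) ℝ) := by
    ext i j
    rw [Matrix.gram_apply, ContinuousLinearMap.coe_coe, (φ.factor_spec.2 x hx).2,
      OrthonormalBasis.inner_eq_ite, Matrix.smul_apply, Matrix.one_apply, smul_eq_mul]
  rw [h2, Matrix.det_smul, Matrix.det_one, mul_one, Fintype.card_fin, ← pow_mul, mul_comm,
    pow_mul, RCLike.ofReal_real_eq_id, id,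
    sq_eq_sq₀ (LinearMap.normDet_nonneg _) (pow_nonneg (φ.factor_pos hx).le _),
    LinearMap.normDet_eq_abs_det] at h
  exact h

/-- Change of variables: the Jacobian is `Ω^d`, and `-(d + 2) / 2 + d = (d - 2) / 2`. -/
theorem integral_W_mul (f : Test d) (H : Euc d → ℝ) :
    ∫ y, φ.W f y * H y = ∫ x in (disk d : Set (Euc d)),
      φ.factor x ^ (((d : ℝ) - 2) / 2) * f x * H (extend φ.toFun x) := by
  have h1 : ∫ y, φ.W f y * H y =
      ∫ y in extend φ.toFun '' (disk d : Set (Euc d)), φ.W f y * H y := by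
    refine (setIntegral_eq_integral_of_forall_compl_eq_zero fun y hy => ?_).symm
    rw [show φ.W f y = 0 from φ.weight_of_forall_ne f y fun x hx => hy ⟨x, x.2, ?_⟩, zero_mul]
    rw [extend_coe, hx]
  have hinj : InjOn (extend φ.toFun) (disk d) := by
    intro x hx y hy hxy
    have h2 := extend_coe φ.toFun ⟨x, hx⟩
    have h3 := extend_coe φ.toFun ⟨y, hy⟩
    exact congrArg Subtype.val (φ.isOpenEmbedding.injective
      (Subtype.ext (h2.symm.trans (hxy.trans h3))))
  have h2 := integral_image_eq_integral_abs_det_fderiv_smul volume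
    (s := (disk d : Set (Euc d))) (disk d).2.measurableSet
    (fun x hx => ((φ.contDiffAt hx).differentiableAt (by simp)).hasFDerivAt.hasFDerivWithinAt)
    hinj fun y => φ.W f y * H y
  rw [h1, h2]
  refine setIntegral_congr_fun (disk d).2.measurableSet fun x hx => ?_
  have h0 := φ.factor_pos hx
  rw [φ.abs_det_fderiv hx, φ.W_extend f hx, smul_eq_mul, ← mul_assoc, ← mul_assoc,
    ← Real.rpow_natCast, ← Real.rpow_add h0]
  congr 4
  ring

theorem integral_disk_mul (f : Test d) (H : Euc d → ℝ) :
    ∫ x, f x * H x = ∫ x in (disk d : Set (Euc d)), f x * H x := by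
  refine (setIntegral_eq_integral_of_forall_compl_eq_zero fun y hy => ?_).symm
  rw [image_eq_zero_of_notMem_tsupport fun h => hy (f.tsupport_subset h), zero_mul]

/-- Conformal invariance of the Green pairing. -/
theorem greenPairing_W (hd : 3 ≤ d) (f g : Test d) :
    greenPairing (φ.W f) (φ.W g) = greenPairing f g := by
  -- The substitution in `y` supplies one of the two weights needed to transform the kernel; the one
  -- in `x` supplies the other.
  have key : ∀ x ∈ (disk d : Set (Euc d)), φ.factor x ^ (((d : ℝ) - 2) / 2) *
      ∫ y, green (extend φ.toFun x, y) * φ.W g y = ∫ y, green (x, y) * g y := by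
    intro x hx
    simp_rw [mul_comm (green _)]
    rw [integral_W_mul, integral_disk_mul, ← integral_const_mul]
    refine setIntegral_congr_fun (disk d).2.measurableSet fun y hy => ?_
    rw [← φ.green_extend hd hx hy]
    ring
  rw [greenPairing_apply, greenPairing_apply, integral_W_mul, integral_disk_mul]
  refine setIntegral_congr_fun (disk d).2.measurableSet fun x hx => ?_
  rw [← key x hx]
  ring

/-- `Ω_φ² h` as a test function. -/
def sqFactorMul (h : Test d) : Test d :=
  Test.ofContDiffOn (fun x => φ.factor x ^ 2 * h x)
    ((φ.factor_spec.1.pow 2).mul h.contDiff.contDiffOn) (tsupport h) h.hasCompactSupport.isCompact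
    h.tsupport_subset fun x hx => by rw [image_eq_zero_of_notMem_tsupport hx, mul_zero]

/-- The weight `(d - 2) / 2` action `h ↦ (Ω_φ^{-(d-2)/2} h) ∘ φ⁻¹`. -/
def V (h : Test d) : Test d := φ.W (φ.sqFactorMul h)

theorem V_extend (h : Test d) {x : Euc d} (hx : x ∈ disk d) :
    φ.V h (extend φ.toFun x) = φ.factor x ^ (-((d : ℝ) - 2) / 2) * h x := by
  have h0 := φ.factor_pos hx
  rw [V, W_extend φ _ hx, sqFactorMul, Test.coe_ofContDiffOn, ← mul_assoc, ← Real.rpow_natCast,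
    ← Real.rpow_add h0]
  congr 2
  push_cast
  ring

/-- The weights `(d + 2) / 2` and `(d - 2) / 2` add up to `d`, the weight of a density. -/
theorem l2_W_V (f h : Test d) : l2 (φ.W f) (φ.V h) = l2 f h := by
  rw [l2_apply, l2_apply, integral_W_mul, integral_disk_mul]
  refine setIntegral_congr_fun (disk d).2.measurableSet fun x hx => ?_
  have h0 := φ.factor_pos hx
  rw [V_extend φ h hx, show ∀ a b c e : ℝ, a * b * (c * e) = a * c * (b * e) from
    fun a b c e => by ring, ← Real.rpow_add h0, show ((d : ℝ) - 2) / 2 + -((d : ℝ) - 2) / 2 = 0 by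
    ring, Real.rpow_zero, one_mul]

/-- The preimage is `Ω^{(d+2)/2} · (g ∘ φ)`, extended by zero. It has compact support since `φ` is
an embedding whose image contains the support of `g`. -/
theorem exists_W_eq (g : Test d) (hg : tsupport g ⊆ extend φ.toFun '' (disk d : Set (Euc d))) :
    ∃ f, φ.W f = g := by
  classical
  set K : Set (Euc d) := Subtype.val '' ((fun x => (φ.toFun x : Euc d)) ⁻¹' tsupport g) with hK
  have hemb : Topology.IsInducing fun x => (φ.toFun x : Euc d) :=
    Topology.IsInducing.subtypeVal.comp φ.isOpenEmbedding.isInducing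
  have hKc : IsCompact K := by
    refine ((hemb.isCompact_preimage_iff fun y hy => ?_).2 g.hasCompactSupport).image
      continuous_subtype_val
    obtain ⟨x, hx, rfl⟩ := hg hy
    exact ⟨⟨x, hx⟩, (extend_coe φ.toFun ⟨x, hx⟩).symm⟩
  have hKd : K ⊆ disk d := by
    rintro _ ⟨x, -, rfl⟩
    exact x.2
  set F : Euc d → ℝ := fun x => if x ∈ disk d then
    φ.factor x ^ (((d : ℝ) + 2) / 2) * g (extend φ.toFun x) else 0 with hF
  have hFd : ∀ x ∈ disk d, F x = φ.factor x ^ (((d : ℝ) + 2) / 2) * g (extend φ.toFun x) :=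
    fun x hx => if_pos hx
  refine ⟨Test.ofContDiffOn F ?_ K hKc hKd ?_, ?_⟩
  · refine ContDiffOn.congr ?_ hFd
    exact (φ.factor_spec.1.rpow_const_of_ne fun x hx => (φ.factor_pos hx).ne').mul
      (g.contDiff.comp_contDiffOn φ.smooth)
  · intro x hx
    by_cases hxd : x ∈ disk d
    · suffices h : extend φ.toFun x ∉ tsupport g by
        rw [hFd x hxd, image_eq_zero_of_notMem_tsupport h, mul_zero]
      intro h
      refine hx ⟨⟨x, hxd⟩, ?_, rfl⟩
      rw [mem_preimage, ← extend_coe]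
      exact h
    · exact if_neg hxd
  · ext y
    by_cases h : ∃ x : disk d, (φ.toFun x : Euc d) = y
    · obtain ⟨x, rfl⟩ := h
      have h0 := φ.factor_pos x.2
      rw [← extend_coe, W_extend φ _ x.2, Test.coe_ofContDiffOn, hFd x x.2, ← mul_assoc,
        ← Real.rpow_add h0, show -((d : ℝ) + 2) / 2 + ((d : ℝ) + 2) / 2 = 0 by ring,
        Real.rpow_zero, one_mul]
    · suffices hy : y ∉ tsupport g by
        rw [coe_W, weight, dif_neg h, image_eq_zero_of_notMem_tsupport hy]
      intro hy
      obtain ⟨x, hx, rfl⟩ := hg hy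
      exact h ⟨⟨x, hx⟩, (extend_coe φ.toFun ⟨x, hx⟩).symm⟩

theorem coe_lap (f : Test d) : (lap f : Euc d → ℝ) = -Laplacian.laplacian (f : Euc d → ℝ) := rfl

theorem tsupport_coe_lap (f : Test d) : tsupport (lap f) ⊆ tsupport f := by
  rw [coe_lap, tsupport_neg]
  exact tsupport_lap f

/-- Conformal covariance of the Laplacian. -/
theorem W_lap (hd : 3 ≤ d) (h : Test d) : φ.W (lap h) = lap (φ.V h) := by
  -- For `g` supported in the image, `Δg = W_φ f` for some `f`. Invariance of the Green pairing
  -- reduces the left side to `∫ f h`, self-adjointness of `Δ` and duality of `W_φ`, `V_φ` the right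
  -- side.
  have key : ∀ g : Test d, tsupport g ⊆ extend φ.toFun '' (disk d : Set (Euc d)) →
      l2 (φ.W (lap h)) g = l2 (lap (φ.V h)) g := by
    intro g hg
    obtain ⟨f, hf⟩ := φ.exists_W_eq (lap g) ((tsupport_coe_lap g).trans hg)
    rw [l2_lap hd, ← greenPairing_lap hd, ← hf, greenPairing_W φ hd, greenPairing_symm,
      greenPairing_lap hd, l2_symm _ (φ.W f), l2_W_V]
  have hK : IsClosed (φ.image h) := (φ.isCompact_image h).isClosed
  have hs : tsupport (φ.W (lap h) - lap (φ.V h) : Test d) ⊆ φ.image h := by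
    refine closure_minimal (fun y hy => ?_) hK
    by_contra hyK
    refine hy ?_
    have h1 : φ.W (lap h) y = 0 := φ.weight_eq_zero _ fun h1 =>
      hyK (image_mono (tsupport_coe_lap h) h1)
    have h2 : lap (φ.V h) y = 0 := by
      refine image_eq_zero_of_notMem_tsupport fun h2 => ?_
      obtain ⟨x, hx, hxy⟩ := φ.tsupport_weight _ (tsupport_coe_lap _ h2)
      refine hyK ⟨x, ?_, hxy⟩
      refine closure_mono (show Function.support (φ.sqFactorMul h) ⊆ Function.support h from
        fun z hz h0 => hz ?_) hx
      change φ.factor z ^ 2 * h z = 0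
      rw [h0, mul_zero]
    change φ.W (lap h) y - lap (φ.V h) y = 0
    rw [h1, h2, sub_zero]
  -- The difference of the two sides is itself supported in the image, hence an admissible `g`.
  refine sub_eq_zero.1 (Test.eq_zero_of_l2_self _ ?_)
  have h3 := key _ (hs.trans (image_mono h.tsupport_subset))
  rw [LinearMap.map_sub₂, h3, sub_self]

theorem l2_W_W_eq_zero (ψ : ConfEmb d) (h : Disjoint (range φ.toFun) (range ψ.toFun))
    (f g : Test d) : l2 (φ.W f) (ψ.W g) = 0 := by
  rw [l2_apply]
  refine integral_eq_zero_of_ae (.of_forall fun y => ?_)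
  by_contra hy
  obtain ⟨h1, h2⟩ := mul_ne_zero_iff.1 hy
  obtain ⟨x, hx⟩ := φ.mem_range_of_W_ne_zero h1
  obtain ⟨z, hz⟩ := ψ.mem_range_of_W_ne_zero h2
  exact Set.disjoint_left.1 h ⟨x, rfl⟩ ⟨z, Subtype.ext (hz.trans hx.symm)⟩

end ConfEmb
end Covariance

/-! ### The operad action on quantum and classical observables. -/

section Observables
open SymmetricAlgebra TensorProduct
variable {d : ℕ}

theorem symMap_id {V : Type*} [AddCommGroup V] [Module ℝ V] (x : SymmetricAlgebra ℝ V) :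
    symMap (LinearMap.id : V →ₗ[ℝ] V) x = x := by
  induction x using sym_induction_ι_mul with
  | one => simp
  | add x y hx hy => simp [hx, hy]
  | smul r x hx => simp [hx]
  | mul f x hx => rw [map_mul, hx, symMap_ι, LinearMap.id_apply]

theorem symMap_comp {V W X : Type*} [AddCommGroup V] [Module ℝ V] [AddCommGroup W] [Module ℝ W]
    [AddCommGroup X] [Module ℝ X] (S : W →ₗ[ℝ] X) (T : V →ₗ[ℝ] W) (x : SymmetricAlgebra ℝ V) :
    symMap (S ∘ₗ T) x = symMap S (symMap T x) := by
  induction x using sym_induction_ι_mul with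
  | one => simp
  | add x y hx hy => simp [hx, hy]
  | smul r x hx => simp [hx]
  | mul f x hx => rw [map_mul, map_mul, map_mul, hx, symMap_ι, symMap_ι, symMap_ι,
      LinearMap.comp_apply]

theorem W0_one (hd : 3 ≤ d) (x : PTest d) : W0 1 x = x := by
  rw [W0, ConfEmb.W_one (by omega), symMap_id]

theorem W0_mul (hd : 3 ≤ d) (φ ψ : ConfEmb d) (x : PTest d) :
    W0 (φ * ψ) x = W0 φ (W0 ψ x) := by
  rw [W0, ConfEmb.W_mul _ (by omega), symMap_comp, W0, W0]

theorem expGreen_W0 (hd : 3 ≤ d) (φ : ConfEmb d) (x : PTest d) :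
    expGreen (W0 φ x) = W0 φ (expGreen x) :=
  expContraction_symMap _ _ _ _ _ (φ.greenPairing_W hd) x

theorem toPScl_surjective : Function.Surjective (toPScl (d := d)) :=
  symMap_surjective _ (Submodule.mkQ_surjective _)

theorem toFCL_surjective : Function.Surjective (toFCL (d := d)) :=
  Submodule.mkQ_surjective _

theorem toPScl_ι (f : Test d) : toPScl (ι ℝ (Test d) f) = cls f := symMap_ι _ f

/-- The isomorphism `F_CL(𝔻) ≃ P(S^cl(𝔻))` induced by `exp (∂_G)`. -/
def psiGreen (hd : 3 ≤ d) : FCL d ≃ₗ[ℝ] PScl d :=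
  (Submodule.Quotient.equiv _ _ (expContractionEquiv greenPairing greenPairing_symm)
    (map_range_bvOperator l2 lap greenPairing greenPairing_symm (greenPairing_lap hd))).trans
  (LinearMap.quotKerEquivOfSurjective toPScl.toLinearMap toPScl_surjective)

theorem psiGreen_toFCL (hd : 3 ≤ d) (x : PTest d) :
    psiGreen hd (toFCL x) = toPScl (expGreen x) := rfl

/-- `W_φ⁰` maps the image of the BV operator to itself, also after multiplication by a polynomial
in functions orthogonal to those supported in the image of `φ`. -/
theorem mul_W0_mem_range_bv (hd : 3 ≤ d) (φ : ConfEmb d) (P : PTest d)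
    (hP : ∀ h, symDeriv (l2.flip (φ.V h)) P = 0) {z : PTest d} (hz : z ∈ LinearMap.range (bv d)) :
    P * W0 φ z ∈ LinearMap.range (bv d) := by
  obtain ⟨z, rfl⟩ := hz
  induction z using TensorProduct.induction_on with
  | zero => simp
  | add a b ha hb =>
    rw [map_add, map_add, mul_add]
    exact Submodule.add_mem _ ha hb
  | tmul x h =>
    -- The derivation attached to `V_φ h` kills `P` and corresponds on `W⁰_φ x` to that attached to
    -- `h`, while `Δ V_φ h = W_φ Δh`.
    refine ⟨(P * W0 φ x) ⊗ₜ φ.V h, ?_⟩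
    have h1 : symDeriv (l2.flip (φ.V h)) (W0 φ x) = W0 φ (symDeriv (l2.flip h) x) :=
      symDeriv_symMap φ.W _ _ (fun f => φ.l2_W_V f h) x
    have h2 : W0 φ (ι ℝ (Test d) (lap h)) = ι ℝ (Test d) (lap (φ.V h)) := by
      rw [W0, symMap_ι, φ.W_lap hd]
    rw [bv, bvOperator_tmul_apply, bvOperator_tmul_apply, symDeriv_mul, hP, h1, map_sub, map_mul, h2]
    ring

theorem W0_mem_range_bv (hd : 3 ≤ d) (φ : ConfEmb d) {z : PTest d}
    (hz : z ∈ LinearMap.range (bv d)) : W0 φ z ∈ LinearMap.range (bv d) := by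
  have := mul_W0_mem_range_bv hd φ 1 (fun h => symDeriv_one _) hz
  rwa [one_mul] at this

/-- `V_{φᵢ} h` lies in the image of `W_{φᵢ}`, so disjointness makes it orthogonal to every `W_{φⱼ}
f` with `j ≠ i`. -/
theorem symDeriv_prod_W0_eq_zero {ι : Type} [DecidableEq ι] (φ : CE d ι) (s : Finset ι) {i : ι}
    (hi : i ∉ s) (x : ι → PTest d) (h : Test d) :
    symDeriv (l2.flip ((φ.emb i).V h)) (∏ j ∈ s, W0 (φ.emb j) (x j)) = 0 := by
  rw [symDeriv_finset_prod]
  refine Finset.sum_eq_zero fun j hj => ?_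
  have h0 : symDeriv (0 : Test d →ₗ[ℝ] ℝ) (x j) = 0 :=
    LinearMap.congr_fun (map_zero symDerivₗ) (x j)
  have h1 : symDeriv (l2.flip ((φ.emb i).V h)) (W0 (φ.emb j) (x j)) = 0 := by
    rw [W0, symDeriv_symMap (φ.emb j).W 0 _ (fun f => ?_), h0, map_zero]
    exact (φ.emb j).l2_W_W_eq_zero _ (φ.disjoint (ne_of_mem_of_not_mem hj hi)) f _
  rw [h1, zero_mul]

theorem toFCL_prod_update (hd : 3 ≤ d) {ι : Type} [Fintype ι] [DecidableEq ι] (φ : CE d ι)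
    (z : ι → PTest d) (i : ι) (v : PTest d) (hv : toFCL v = toFCL (z i)) :
    toFCL (∏ j, W0 (φ.emb j) (Function.update z i v j)) = toFCL (∏ j, W0 (φ.emb j) (z j)) := by
  have hmem : v - z i ∈ LinearMap.range (bv d) := (Submodule.Quotient.eq _).1 hv
  refine (Submodule.Quotient.eq _).2 ?_
  rw [← Finset.prod_erase_mul _ _ (Finset.mem_univ i),
    ← Finset.prod_erase_mul (Finset.univ) (fun j => W0 (φ.emb j) (z j)) (Finset.mem_univ i),
    Finset.prod_congr rfl fun j hj => by
      rw [Function.update_of_ne (Finset.ne_of_mem_erase hj)],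
    Function.update_self, ← mul_sub, ← map_sub]
  exact mul_W0_mem_range_bv hd _ _
    (symDeriv_prod_W0_eq_zero φ _ (Finset.notMem_erase i _) z) hmem

/-- The representatives are exchanged one index at a time. -/
theorem toFCL_prod_congr (hd : 3 ≤ d) {ι : Type} [Fintype ι] (φ : CE d ι)
    (x y : ι → PTest d) (h : ∀ i, toFCL (x i) = toFCL (y i)) :
    toFCL (∏ j, W0 (φ.emb j) (x j)) = toFCL (∏ j, W0 (φ.emb j) (y j)) := by
  classical
  have key : ∀ s : Finset ι, toFCL (∏ j, W0 (φ.emb j) (s.piecewise x y j)) =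
      toFCL (∏ j, W0 (φ.emb j) (y j)) := by
    intro s
    induction s using Finset.induction_on with
    | empty => simp
    | insert i s hi ih =>
      rw [Finset.piecewise_insert, toFCL_prod_update hd φ, ih]
      rw [Finset.piecewise_eq_of_notMem _ _ _ hi, h]
  simpa using key Finset.univ

/-- A linear section of the projection onto `F_CL(𝔻)`. -/
def fclSection (d : ℕ) : FCL d →ₗ[ℝ] PTest d :=
  ((toFCL (d := d)).exists_rightInverse_of_surjective
    (LinearMap.range_eq_top.2 toFCL_surjective)).choose

theorem toFCL_fclSection (y : FCL d) : toFCL (fclSection d y) = y :=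
  LinearMap.congr_fun ((toFCL (d := d)).exists_rightInverse_of_surjective
    (LinearMap.range_eq_top.2 toFCL_surjective)).choose_spec y

/-- The operations `[x₁] ⊗ ⋯ ⊗ [xₙ] ↦ [W⁰_{φ₁}(x₁) ⋯ W⁰_{φₙ}(xₙ)]`. -/
def fclOperations (d : ℕ) : Operations d (FCL d) := fun ι _ φ =>
  PiTensorProduct.lift <| toFCL.compMultilinearMap <|
    (MultilinearMap.mkPiAlgebra ℝ ι (PTest d)).compLinearMap fun i =>
      (W0 (φ.emb i)).toLinearMap ∘ₗ fclSection d

/-- This shows that the linear section used in the definition does not matter. -/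
theorem fclOperations_tprod (hd : 3 ≤ d) (ι : Type) [Fintype ι] (φ : CE d ι) (x : ι → PTest d) :
    fclOperations d ι φ (⨂ₜ[ℝ] i, toFCL (x i)) = toFCL (∏ i, W0 (φ.emb i) (x i)) := by
  rw [fclOperations, PiTensorProduct.lift.tprod]
  exact toFCL_prod_congr hd φ _ _ fun i => toFCL_fclSection _

/-- The action of conformal embeddings on `F_CL(𝔻)`. -/
def fclHom (hd : 3 ≤ d) : ConfEmb d →* Module.End ℝ (FCL d) where
  toFun φ := (LinearMap.range (bv d)).mapQ (LinearMap.range (bv d)) (W0 φ).toLinearMap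
    fun _ hz => W0_mem_range_bv hd φ hz
  map_one' := by
    refine LinearMap.ext fun y => ?_
    obtain ⟨x, rfl⟩ := toFCL_surjective y
    exact congrArg toFCL (W0_one hd x)
  map_mul' φ ψ := by
    refine LinearMap.ext fun y => ?_
    obtain ⟨x, rfl⟩ := toFCL_surjective y
    exact congrArg toFCL (W0_mul hd φ ψ x)

theorem fclHom_toFCL (hd : 3 ≤ d) (φ : ConfEmb d) (x : PTest d) :
    fclHom hd φ (toFCL x) = toFCL (W0 φ x) := rfl

/-- The map induced by `W_φ` on `C_c^∞(𝔻) / Δ C_c^∞(𝔻)`. -/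
def sclMap (hd : 3 ≤ d) (φ : ConfEmb d) : Scl d →ₗ[ℝ] Scl d :=
  (LinearMap.range lap).mapQ (LinearMap.range lap) φ.W <| by
    rintro _ ⟨h, rfl⟩
    exact ⟨φ.V h, (φ.W_lap hd h).symm⟩

theorem symMap_sclMap_toPScl (hd : 3 ≤ d) (φ : ConfEmb d) (x : PTest d) :
    symMap (sclMap hd φ) (toPScl x) = toPScl (W0 φ x) := by
  rw [toPScl, W0, ← symMap_comp, ← symMap_comp]
  rfl

/-- The action of conformal embeddings on the classical observables. -/
def psclHom (hd : 3 ≤ d) : ConfEmb d →* Module.End ℝ (PScl d) where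
  toFun φ := (symMap (sclMap hd φ)).toLinearMap
  map_one' := by
    refine LinearMap.ext fun y => ?_
    obtain ⟨x, rfl⟩ := toPScl_surjective y
    exact (symMap_sclMap_toPScl hd 1 x).trans (congrArg toPScl (W0_one hd x))
  map_mul' φ ψ := by
    refine LinearMap.ext fun y => ?_
    obtain ⟨x, rfl⟩ := toPScl_surjective y
    change symMap _ _ = symMap (sclMap hd φ) (symMap (sclMap hd ψ) _)
    rw [symMap_sclMap_toPScl, symMap_sclMap_toPScl, symMap_sclMap_toPScl, W0_mul hd]

theorem psclHom_toPScl (hd : 3 ≤ d) (φ : ConfEmb d) (x : PTest d) :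
    psclHom hd φ (toPScl x) = toPScl (W0 φ x) := symMap_sclMap_toPScl hd φ x

theorem psiGreen_fclHom (hd : 3 ≤ d) (φ : ConfEmb d) (y : FCL d) :
    psiGreen hd (fclHom hd φ y) = psclHom hd φ (psiGreen hd y) := by
  obtain ⟨x, rfl⟩ := toFCL_surjective y
  rw [fclHom_toFCL, psiGreen_toFCL, psiGreen_toFCL, expGreen_W0 hd, psclHom_toPScl]

theorem transport_tprod (hd : 3 ≤ d) {A : Type} [AddCommGroup A] [Module ℝ A]
    (Ψ : FCL d ≃ₗ[ℝ] A) (ι : Type) [Fintype ι] (φ : CE d ι) (x : ι → PTest d) :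
    transport Ψ (fclOperations d) ι φ (⨂ₜ[ℝ] i, Ψ (toFCL (x i))) =
      Ψ (toFCL (∏ i, W0 (φ.emb i) (x i))) := by
  rw [transport, LinearMap.comp_apply, LinearMap.comp_apply, PiTensorProduct.map_tprod]
  simp only [LinearEquiv.coe_coe, LinearEquiv.symm_apply_apply]
  rw [fclOperations_tprod hd]

theorem isCEAlgebra_transport (hd : 3 ≤ d) {A : Type} [AddCommGroup A] [Module ℝ A]
    (Ψ : FCL d ≃ₗ[ℝ] A) : IsCEAlgebra (transport Ψ (fclOperations d)) := by
  -- Every family of arguments comes from polynomials, so the axioms become identities between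
  -- products of `W⁰` in a commutative algebra.
  have hsurj : ∀ {J : Type} (a : J → A), ∃ x : J → PTest d, (fun j => Ψ (toFCL (x j))) = a := by
    intro J a
    choose x hx using fun j => (Ψ.surjective.comp toFCL_surjective) (a j)
    exact ⟨x, funext hx⟩
  refine ⟨fun a => ?_, fun ι _ κ _ φ ψ a => ?_, fun ι κ _ _ σ φ a => ?_⟩
  · obtain ⟨x, hx⟩ := hsurj fun _ : Fin 1 => a
    rw [← hx, transport_tprod hd, Fin.prod_univ_one]
    exact (congrArg (fun z => Ψ (toFCL z)) (W0_one hd _)).trans (congrFun hx 0)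
  · obtain ⟨x, rfl⟩ := hsurj a
    simp only [transport_tprod hd, Fintype.prod_sigma, map_prod]
    congr 2
    exact Finset.prod_congr rfl fun i _ => Finset.prod_congr rfl fun k _ => W0_mul hd _ _ _
  · obtain ⟨x, rfl⟩ := hsurj a
    simp only [transport_tprod hd]
    congr 2
    exact Equiv.prod_comp σ fun k => W0 (φ.emb k) (x k)

theorem prod_filter_sigma_fst {I M : Type*} [Fintype I] [DecidableEq I] [CommMonoid M]
    {κ : I → Type*} [∀ i, Fintype (κ i)] (F : (Σ i, κ i) → M) (i : I) :
    ∏ s with s.1 = i, F s = ∏ a, F ⟨i, a⟩ := by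
  rw [Finset.prod_filter, Fintype.prod_sigma, Fintype.prod_eq_single i]
  · simp
  · intro j hj
    simp [hj]

/-- The empty pattern contributes the uncontracted product and is separated from the rest. -/
theorem toPScl_groupSum {n : ℕ} {m : Fin n → ℕ} (g : (Σ i, Fin (m i)) → Test d) :
    toPScl (groupSum greenPairing Sigma.fst g Finset.univ) = (∏ s, cls (g s)) + wickSum g := by
  classical
  have h1 : ∀ C, toPScl (groupTerm greenPairing g Finset.univ C) = wickTerm g C := by
    intro C
    rw [groupTerm, wickTerm, map_smul, map_prod]
    simp only [toPScl_ι]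
    congr 2
    ext
    simp
  have h2 : wickTerm g ∅ = ∏ s, cls (g s) := by simp [wickTerm]
  rw [groupSum, map_sum, ← h2, wickSum]
  simp only [h1]
  rw [← Finset.sum_insert (by simp)]
  have h3 : ∀ C : Finset ((Σ i, Fin (m i)) × (Σ i, Fin (m i))),
      IsGroupPattern Sigma.fst Finset.univ C ↔ IsPattern C := fun C => by
    simp only [IsGroupPattern, IsPattern, Finset.mem_univ, and_true]
  refine Finset.sum_congr ?_ fun _ _ => rfl
  ext C
  simp only [Finset.mem_filter, Finset.mem_insert, Finset.mem_univ, true_and, h3,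
    Finset.univ_product_univ, Finset.powerset_univ]
  rcases C.eq_empty_or_nonempty with rfl | hC
  · simp only [true_or, iff_true]
    exact ⟨by simp, by simp⟩
  · simp only [hC, hC.ne_empty, false_or, and_true]

theorem transport_prod_cls (hd : 3 ≤ d) (n : ℕ) (φ : CE d (Fin n)) (m : Fin n → ℕ)
    (f : ∀ i, Fin (m i) → Test d) :
    transport (psiGreen hd) (fclOperations d) (Fin n) φ (⨂ₜ[ℝ] i, ∏ a, cls (f i a)) =
      ∏ i, psclHom hd (φ.emb i) (∏ a, cls (f i a)) +
        wickSum fun s : Σ i, Fin (m i) => (φ.emb s.1).W (f s.1 s.2) := by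
  have hG' : ∀ f g : Test d, (-greenPairing) f g = (-greenPairing) g f := fun f g => by
    simp [greenPairing_symm f g]
  have h1 : ∀ i, ∏ a, cls (f i a) = toPScl (∏ a, ι ℝ (Test d) (f i a)) := fun i => by
    simp only [map_prod, toPScl_ι]
  -- Inverting `Ψ` on a monomial amounts to normal ordering its representatives with `exp(-∂_G)`.
  have h2 : ∀ i, ∏ a, cls (f i a) = psiGreen hd (toFCL
      (expContraction (-greenPairing) hG' (∏ a, ι ℝ (Test d) (f i a)))) := fun i => by
    rw [psiGreen_toFCL, expGreen, expContraction_add_eq_zero _ _ _ _ (by abel), h1]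
  -- Conformal invariance moves `W⁰` inside the normal ordering, which brings the product into the
  -- form required by Wick's theorem.
  have h3 : ∏ i, W0 (φ.emb i) (expContraction (-greenPairing) hG' (∏ a, ι ℝ (Test d) (f i a))) =
      groupExp (-greenPairing) hG' Sigma.fst
        (fun s : Σ i, Fin (m i) => (φ.emb s.1).W (f s.1 s.2)) Finset.univ := by
    rw [groupExp]
    refine Finset.prod_congr rfl fun i _ => ?_
    rw [prod_filter_sigma_fst, W0, ← expContraction_symMap (-greenPairing) hG' _ (-greenPairing) hG'
      fun f g => by simp [(φ.emb i).greenPairing_W hd], map_prod]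
    simp only [symMap_ι]
  have h4 : ∏ i, psclHom hd (φ.emb i) (∏ a, cls (f i a)) =
      ∏ s : Σ i, Fin (m i), cls ((φ.emb s.1).W (f s.1 s.2)) := by
    rw [Fintype.prod_sigma]
    refine Finset.prod_congr rfl fun i _ => ?_
    rw [h1, psclHom_toPScl, W0]
    simp only [map_prod, symMap_ι, toPScl_ι]
  rw [h4, ← toPScl_groupSum, ← expContraction_groupExp greenPairing greenPairing_symm _ _
    (-greenPairing) hG' rfl, ← h3]
  simp only [h2]
  rw [transport_tprod hd, psiGreen_toFCL]
  rfl

end Observables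
end ConfFA
end

theorem mainTheorem3 (d : ℕ) (hd : 3 ≤ d) :
    ∃ (Ψ : FCL d ≃ₗ[ℝ] PScl d)
      (F₁ : ConfEmb d →* Module.End ℝ (FCL d))
      (F : Operations d (FCL d))
      (Wcl : ConfEmb d →* Module.End ℝ (PScl d)),
      -- `Ψ` is induced by `exp (∂_G)`
      (∀ x : PTest d, Ψ (toFCL x) = toPScl (expGreen x)) ∧
      -- `F₁ φ` and `F ι φ` are the maps that `F_CL` attaches to conformal open embeddings
      (∀ (φ : ConfEmb d) (x : PTest d), F₁ φ (toFCL x) = toFCL (W0 φ x)) ∧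
      (∀ (ι : Type) [Fintype ι] (φ : CE d ι) (x : ι → PTest d),
        F ι φ (⨂ₜ[ℝ] i, toFCL (x i)) = toFCL (∏ i, W0 (φ.emb i) (x i))) ∧
      -- `Wcl φ` is induced by `W_φ^0`
      (∀ (φ : ConfEmb d) (x : PTest d), Wcl φ (toPScl x) = toPScl (W0 φ x)) ∧
      -- naturality of `Ψ`
      (∀ φ : ConfEmb d, Ψ.toLinearMap ∘ₗ F₁ φ = Wcl φ ∘ₗ Ψ.toLinearMap) ∧
      -- the transported operations form an algebra over the operad
      IsCEAlgebra (transport Ψ F) ∧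
      -- unary operations
      (∀ (φ : ConfEmb d) (z : PScl d),
        transport Ψ F (Fin 1) (CE.ofConfEmb φ) (⨂ₜ[ℝ] _, z) = Wcl φ z) ∧
      -- `n`-ary operations
      (∀ (n : ℕ) (φ : CE d (Fin n)) (m : Fin n → ℕ) (f : ∀ i, Fin (m i) → Test d),
        transport Ψ F (Fin n) φ (⨂ₜ[ℝ] i, ∏ a, cls (f i a)) =
          ∏ i, Wcl (φ.emb i) (∏ a, cls (f i a)) +
            wickSum fun s : Σ i, Fin (m i) => (φ.emb s.1).W (f s.1 s.2)) := by
  refine ⟨psiGreen hd, fclHom hd, fclOperations d, psclHom hd, psiGreen_toFCL hd, fclHom_toFCL hd,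
    fclOperations_tprod hd, psclHom_toPScl hd, fun φ => LinearMap.ext (psiGreen_fclHom hd φ),
    isCEAlgebra_transport hd _, fun φ z => ?_, transport_prod_cls hd⟩
  obtain ⟨y, rfl⟩ := (psiGreen hd).surjective z
  obtain ⟨x, rfl⟩ := toFCL_surjective y
  rw [← psiGreen_fclHom, fclHom_toFCL,
    transport_tprod hd (psiGreen hd) (Fin 1) (CE.ofConfEmb φ) fun _ => x, Fin.prod_univ_one]
  rfl
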